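/- Let $c_0>c_1>0$, $a>0$, $\rho\ge 0$, and let $R=R_L$ and $N=N_L$ be sequences of non-negative integers with $R_L/L\to a$ and $N_L/L\to\rho$ as $L\to\infty$. Consider the zero-range process on $L$ sites $\{1,\dots,L\}$ with jump rates $g_R(0)=0$, $g_R(k)=c_0$ for $1\le k\le R$ and $g_R(k)=c_1$ for $k>R$. Its stationary weights are $w_R(k)=\prod_{i=1}^{k}g_R(i)^{-1}$ and $w_R^L(\eta)=\prod_{x=1}^{L}w_R(\eta_x)$ for $\eta\in\mathbb N^{L}$, $\mathbb N=\{0,1,2,\dots\}$. Let $X_{L,N}=\{\eta:\sum_x\eta_x=N\}$, let $X^m_{L,N}$ be the set of $\eta\in X_{L,N}$ with $\eta_x>R$ for exactly $m$ sites $x$, and let $\pi_{L,N}$ be the canonical measure, i.e. the probability measure on $X_{L,N}$ with mass function $w_R^L(\eta)/\sum_{\zeta\in X_{L,N}}w_R^L(\zeta)$. Let $\tilde\pi_{L,N}$ be the law of $(\eta_1,\dots,\eta_{L-1})$ under $\pi_{L,N}$ conditioned on $\eta\in X^1_{L,N}$ and $\eta_L\ge\eta_x$ for all $x$ (the background). (The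 conditional measures are considered for $L$ large enough for the conditioning events to be non-empty.) For $0\le\phi<c_0$ let $\nu_{\phi,\infty}$ be the product measure on $\mathbb N^{\{1,2,\dots\}}$ with geometric marginals $\nu^1_{\phi,\infty}(k)=(1-\phi/c_0)(\phi/c_0)^k$ (with $0^0=1$), and $\nu^L_{\phi,\infty}$ the product of $L$ such marginals. Put $\phi_\infty(\rho)=c_0\,\rho/(1+\rho)$ and $\rho_c=c_1/(c_0-c_1)$. Let $H(\mu,\nu)\in[0,\infty]$ denote relative entropy, and say that measures $\mu_L$ on $\mathbb N^L$ converge weakly to a measure $\nu$ on $\mathbb N^{\{1,2,\dots\}}$ if $\langle f\rangle_{\mu_L}\to\langle f\rangle_\nu$ for every bounded function $f$ that depends on finitely many coordinates. Then, as $L\to\infty$: 1. For all $\rho\ge 0$, $\pi_{L,N}(\,\cdot\,|X^0_{L,N})\to\nu_{\phi_\infty(\rho),\infty}$ weakly. Moreover, provided that $\rho>0$, or that $\rho=0$ and $N_L=0$ for all large $L$, $$\frac1L\,H\big(\pi_{L,N}(\,\cdot\,|X^0_{L,N}),\,\nu^L_{\phi_\infty(\rho),\infty}\big)\to 0 .$$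 2. For all $\rho\ge\rho_c+a$, $\pi_{L,N}(\,\cdot\,|X^1_{L,N})\to\nu_{c_1,\infty}$ weakly. Moreover, provided that $\rho>\rho_c+a$, or that $\rho=\rho_c+a$ and $(N_L-R_L-\rho_cL)/\sqrt L\to+\infty$, $$H\big(\tilde\pi_{L,N},\,\nu^{L-1}_{c_1,\infty}\big)\to 0 .$$ -/

import Mathlib

open MeasureTheory ProbabilityTheory InformationTheory Filter Topology
open scoped ENNReal

namespace ZRP

noncomputable section

/-- Jump rate of the zero-range process out of a site with `k` particles. -/
def jumpRate (c₀ c₁ : ℝ) (R k : ℕ) : ℝ :=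
  if k = 0 then 0 else if k ≤ R then c₀ else c₁

/-- Single-site stationary weight `w_R(k) = ∏_{i=1}^k g_R(i)⁻¹`. -/
def weight (c₀ c₁ : ℝ) (R k : ℕ) : ℝ :=
  ∏ i ∈ Finset.Icc 1 k, (jumpRate c₀ c₁ R i)⁻¹

/-- The single-site partition function `z_R(φ) = ∑_k w_R(k) φ^k`, finite for `0 ≤ φ < c₁`. -/
def partition (c₀ c₁ : ℝ) (R : ℕ) (φ : ℝ) : ℝ :=
  ∑' k, weight c₀ c₁ R k * φ ^ k

/-- Single-site grand-canonical marginal `ν¹_{φ,R}`. -/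
def grandCanonicalMarginal (c₀ c₁ : ℝ) (R : ℕ) (φ : ℝ) : Measure ℕ :=
  Measure.count.withDensity fun k =>
    ENNReal.ofReal (weight c₀ c₁ R k * φ ^ k / partition c₀ c₁ R φ)

/-- The grand-canonical product measure `ν^L_{φ,R}`. -/
def grandCanonical (c₀ c₁ : ℝ) (R : ℕ) (φ : ℝ) (L : ℕ) : Measure (Fin L → ℕ) :=
  Measure.pi fun _ => grandCanonicalMarginal c₀ c₁ R φ

/-- Stationary product weight `w_R^L`, as a measure on the configurations on `L` sites. -/
def weightMeasure (c₀ c₁ : ℝ) (R L : ℕ) : Measure (Fin L → ℕ) :=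
  Measure.count.withDensity fun η => ENNReal.ofReal (∏ x, weight c₀ c₁ R (η x))

/-- Configurations on `L` sites with `N` particles in total. -/
def config (L N : ℕ) : Set (Fin L → ℕ) :=
  {η | ∑ x, η x = N}

/-- Configurations on `L` sites with `N` particles in total, of which exactly `m` sites
hold more than `R` particles. -/
def configWith (R L N m : ℕ) : Set (Fin L → ℕ) :=
  {η | ∑ x, η x = N ∧ (Finset.univ.filter fun x => R < η x).card = m}

/-- The canonical measure `π_{L,N}`: mass function `w_R^L(η) / Z_{L,N}` on the configurations
with `N` particles, where `Z_{L,N} = w_R^L(X_{L,N})`. It is the conditional law of every grand-canonical measure given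
the number of particles, as proved in `canonical_eq_cond_grandCanonical` below. -/
def canonical (c₀ c₁ : ℝ) (R L N : ℕ) : Measure (Fin L → ℕ) :=
  cond (weightMeasure c₀ c₁ R L) (config L N)

theorem weight_pos {c₀ c₁ : ℝ} (h₁ : 0 < c₁) (h : c₁ < c₀) (R k : ℕ) : 0 < weight c₀ c₁ R k := by
  refine Finset.prod_pos fun i hi => inv_pos.2 ?_
  have : i ≠ 0 := by have := (Finset.mem_Icc.1 hi).1; omega
  unfold jumpRate
  rw [if_neg this]
  split_ifs
  · linarith
  · exact h₁

theorem weight_eq {c₀ c₁ : ℝ} (R k : ℕ) :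
    weight c₀ c₁ R k = if k ≤ R then (c₀ ^ k)⁻¹ else (c₀ ^ R)⁻¹ * (c₁ ^ (k - R))⁻¹ := by
  induction k with
  | zero => simp [weight]
  | succ k ih =>
    rw [weight, Finset.prod_Icc_succ_top (by omega), ← weight, ih, jumpRate,
      if_neg (Nat.succ_ne_zero k)]
    by_cases h1 : k + 1 ≤ R
    · have h2 : k ≤ R := by omega
      simp only [h1, h2, if_true, pow_succ, mul_inv]
    · by_cases h2 : k ≤ R
      · have : k = R := by omega
        subst this
        simp
      · simp only [h1, h2, if_false, show k + 1 - R = k - R + 1 by omega, pow_succ, mul_inv,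
          mul_assoc]

theorem summable_weight {c₀ c₁ φ : ℝ} (h₁ : 0 < c₁) (h : c₁ < c₀) (h0 : 0 ≤ φ) (hφ : φ < c₁)
    (R : ℕ) : Summable fun k => weight c₀ c₁ R k * φ ^ k := by
  have hs : Summable fun k : ℕ => (φ / c₁) ^ k :=
    summable_geometric_of_lt_one (by positivity) ((div_lt_one h₁).2 hφ)
  refine Summable.of_nonneg_of_le
    (fun k => mul_nonneg (weight_pos h₁ h R k).le (by positivity)) (fun k => ?_) hs
  have : weight c₀ c₁ R k ≤ (c₁ ^ k)⁻¹ := by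
    rw [← inv_pow]
    calc weight c₀ c₁ R k ≤ ∏ i ∈ Finset.Icc 1 k, c₁⁻¹ := by
          refine Finset.prod_le_prod (fun i _ => ?_) (fun i hi => ?_)
          · unfold jumpRate
            have : 0 < c₀ := h₁.trans h
            split_ifs <;> positivity
          · have : i ≠ 0 := by have := (Finset.mem_Icc.1 hi).1; omega
            unfold jumpRate
            rw [if_neg this]
            split_ifs
            · exact inv_anti₀ h₁ h.le
            · exact le_rfl
      _ = c₁⁻¹ ^ k := by simp
  rw [div_pow, div_eq_inv_mul]
  gcongr

theorem isProbabilityMeasure_grandCanonicalMarginal {c₀ c₁ φ : ℝ} (h₁ : 0 < c₁) (h : c₁ < c₀)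
    (h0 : 0 ≤ φ) (hφ : φ < c₁) (R : ℕ) :
    IsProbabilityMeasure (grandCanonicalMarginal c₀ c₁ R φ) := by
  have hs := summable_weight h₁ h h0 hφ R
  have hn : ∀ k, 0 ≤ weight c₀ c₁ R k * φ ^ k := fun k =>
    mul_nonneg (weight_pos h₁ h R k).le (by positivity)
  have hz : 0 < partition c₀ c₁ R φ := hs.tsum_pos hn 0 (by simp [weight])
  constructor
  rw [grandCanonicalMarginal, withDensity_apply _ MeasurableSet.univ, Measure.restrict_univ,
    lintegral_count, ← ENNReal.ofReal_tsum_of_nonneg (fun k => div_nonneg (hn k) hz.le)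
      (hs.div_const _), tsum_div_const]
  change ENNReal.ofReal (partition c₀ c₁ R φ / partition c₀ c₁ R φ) = 1
  rw [div_self hz.ne', ENNReal.ofReal_one]

/-- The canonical measure is the grand-canonical one conditioned on the number of particles,
whatever the fugacity. -/
theorem canonical_eq_cond_grandCanonical {c₀ c₁ φ : ℝ} (h₁ : 0 < c₁) (h : c₁ < c₀)
    (h0 : 0 < φ) (hφ : φ < c₁) (R L N : ℕ) :
    canonical c₀ c₁ R L N = cond (grandCanonical c₀ c₁ R φ L) (config L N) := by
  have hs := summable_weight h₁ h h0.le hφ R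
  have hn : ∀ k, 0 ≤ weight c₀ c₁ R k * φ ^ k := fun k =>
    mul_nonneg (weight_pos h₁ h R k).le (by positivity)
  have hz : 0 < partition c₀ c₁ R φ := hs.tsum_pos hn 0 (by simp [weight])
  have := isProbabilityMeasure_grandCanonicalMarginal h₁ h h0.le hφ R
  set t : ℝ := φ ^ N / partition c₀ c₁ R φ ^ L with ht
  have htpos : 0 < t := by positivity
  have hms : ∀ s : Set (Fin L → ℕ), MeasurableSet s := fun s => s.to_countable.measurableSet
  have key : (grandCanonical c₀ c₁ R φ L).restrict (config L N)
      = ENNReal.ofReal t • (weightMeasure c₀ c₁ R L).restrict (config L N) := by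
    refine Measure.ext_of_singleton fun η => ?_
    rw [Measure.smul_apply, Measure.restrict_apply (hms _), Measure.restrict_apply (hms _)]
    by_cases hη : η ∈ config L N
    · have e : ({η} : Set (Fin L → ℕ)) ∩ config L N = {η} := by
        ext ζ; simp only [Set.mem_inter_iff, Set.mem_singleton_iff]
        constructor
        · exact fun h => h.1
        · rintro rfl; exact ⟨rfl, hη⟩
      rw [e, grandCanonical, Measure.pi_singleton, weightMeasure,
        withDensity_apply _ (hms _), lintegral_singleton, Measure.count_singleton, mul_one,
        smul_eq_mul, ← ENNReal.ofReal_mul htpos.le]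
      simp only [grandCanonicalMarginal, withDensity_apply _ (MeasurableSet.singleton _),
        lintegral_singleton, Measure.count_singleton, mul_one]
      rw [← ENNReal.ofReal_prod_of_nonneg fun x _ => div_nonneg (hn _) hz.le]
      congr 1
      rw [Finset.prod_div_distrib, Finset.prod_mul_distrib, Finset.prod_pow_eq_pow_sum,
        show ∑ x, η x = N from hη, ht]
      simp
      ring
    · have e : ({η} : Set (Fin L → ℕ)) ∩ config L N = ∅ := by
        ext ζ; simp only [Set.mem_inter_iff, Set.mem_singleton_iff, Set.mem_empty_iff_false,
          iff_false]
        rintro ⟨rfl, h⟩; exact hη h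
      rw [e]; simp
  have key2 : grandCanonical c₀ c₁ R φ L (config L N)
      = ENNReal.ofReal t * weightMeasure c₀ c₁ R L (config L N) := by
    have := congrArg (fun μ => μ Set.univ) key
    simpa using this
  have ht0 : ENNReal.ofReal t ≠ 0 := by simpa using htpos
  rw [canonical, ProbabilityTheory.cond, ProbabilityTheory.cond, key, key2, smul_smul, ENNReal.mul_inv (Or.inl ht0)
    (Or.inl ENNReal.ofReal_ne_top), mul_right_comm, ENNReal.inv_mul_cancel ht0
    ENNReal.ofReal_ne_top, one_mul]

/-- The (quasi-stationary) measure `π_{L,N}( · | X_{L,N}^m)`. -/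
def quasiStationary (c₀ c₁ : ℝ) (R L N m : ℕ) : Measure (Fin L → ℕ) :=
  cond (canonical c₀ c₁ R L N) (configWith R L N m)

/-- The background measure of the condensed phase on `n + 1` sites: the canonical measure
conditioned on the event that exactly one site holds more than `R` particles and that the last
site has maximal occupation, projected to the first `n` sites. -/
def condensedBackground (c₀ c₁ : ℝ) (R n N : ℕ) : Measure (Fin n → ℕ) :=
  (cond (canonical c₀ c₁ R (n + 1) N)
    (configWith R (n + 1) N 1 ∩ {η | ∀ x, η x ≤ η (Fin.last n)})).map
      fun η x => η x.castSucc

/-- `z_∞(φ)`. -/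
def fluidPartition (c₀ φ : ℝ) : ℝ := c₀ / (c₀ - φ)

/-- Single-site marginal `ν¹_{φ,∞}`, a probability measure for `0 ≤ φ < c₀`. -/
def fluidMarginal (c₀ φ : ℝ) : Measure ℕ :=
  Measure.count.withDensity fun k => ENNReal.ofReal ((φ / c₀) ^ k / fluidPartition c₀ φ)

theorem isProbabilityMeasure_fluidMarginal {c₀ φ : ℝ} (h0 : 0 ≤ φ) (hφ : φ < c₀) :
    IsProbabilityMeasure (fluidMarginal c₀ φ) := by
  have hc : 0 < c₀ := lt_of_le_of_lt h0 hφ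
  have hr : φ / c₀ < 1 := (div_lt_one hc).2 hφ
  have hr0 : 0 ≤ φ / c₀ := by positivity
  have hz : 0 < fluidPartition c₀ φ := div_pos hc (sub_pos.2 hφ)
  constructor
  rw [fluidMarginal, withDensity_apply _ MeasurableSet.univ, Measure.restrict_univ,
    lintegral_count, ← ENNReal.ofReal_tsum_of_nonneg (fun k => by positivity)
      ((summable_geometric_of_lt_one hr0 hr).div_const _), tsum_div_const,
    tsum_geometric_of_lt_one hr0 hr]
  have : c₀ - φ ≠ 0 := (sub_pos.2 hφ).ne'
  rw [show (1 - φ / c₀)⁻¹ = fluidPartition c₀ φ by unfold fluidPartition; field_simp,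
    div_self hz.ne', ENNReal.ofReal_one]

/-- The product measure `ν^L_{φ,∞}` on `L` sites. -/
def fluidProduct (c₀ φ : ℝ) (L : ℕ) : Measure (Fin L → ℕ) :=
  Measure.pi fun _ => fluidMarginal c₀ φ

/-- The infinite product measure `ν_{φ,∞}`. -/
def fluidInfinite (c₀ φ : ℝ) : Measure (ℕ → ℕ) :=
  Measure.infinitePi fun _ => fluidMarginal c₀ φ

/-- The density `ρ_∞(φ)`. -/
def fluidDensity (c₀ φ : ℝ) : ℝ := φ / (c₀ - φ)

/-- The fugacity `φ_∞(ρ)`, inverse of `ρ_∞`. -/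
def fluidFugacity (c₀ ρ : ℝ) : ℝ := c₀ * (ρ / (1 + ρ))

/-- The critical density `ρ_c = ρ_∞(c₁)`. -/
def criticalDensity (c₀ c₁ : ℝ) : ℝ := fluidDensity c₀ c₁

/-- A configuration on `L` sites, extended by zero to a configuration on `ℕ`. -/
def extendByZero {L : ℕ} (η : Fin L → ℕ) : ℕ → ℕ :=
  fun x => if h : x < L then η ⟨x, h⟩ else 0

/-- Weak convergence, as `L → ∞`, of measures on the configurations on `L` sites to a measure on
infinite configurations: convergence of the expectations of all bounded cylinder functions
(which are automatically continuous, since the single-site space is discrete). The extension by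
zero plays no role once `L` exceeds the support of the cylinder function. -/
def ConvergesWeakly (μ : (L : ℕ) → Measure (Fin L → ℕ)) (ν : Measure (ℕ → ℕ)) : Prop :=
  ∀ (S : Finset ℕ) (f : (ℕ → ℕ) → ℝ), DependsOn f (S : Set ℕ) →
    (∃ C : ℝ, ∀ η, |f η| ≤ C) →
      Tendsto (fun L => ∫ η, f (extendByZero η) ∂(μ L)) atTop (𝓝 (∫ η, f η ∂ν))

end

end ZRP

/-! A site with at most `R` particles carries the geometric weight `c₀⁻ᵏ`, so both conditioned
measures reduce to a product of geometric laws conditioned on its total and on every occupation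
number being at most `R`. With no site above `R` the total is `N` (`quasiStationary_zero_eq`). With
one such site `y`, its weight is `c₀^(-R) c₁^(-(η_y - R))`; as `η_y` is `N` minus the background
total, this factor tilts the background to fugacity `c₁`, and the only trace of the condensate is
the constraint that the background total stay below `N - R` (`weightMeasure_restrict_condensateAt`).

Weak limits rest on memorylessness: with `p = φ/c₀`, the probability of `s ≤ η` together with `∑ η ∈
D` is `p^|s|` times that of `∑ η + |s| ∈ D`. Hence it suffices that `p^s P(∑ η + s ∈ D) / P(∑ η ∈
D)` tends to `q^s` and that exceeding `R` somewhere is negligible by a union bound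
(`convergesWeakly_cond`). In the fluid phase `D = {N}`, and ratios of consecutive negative binomial
probabilities are explicit, with limit `ρ/(1+ρ)`. In the condensed phase `D` is everything below `N
- R`; at density `ρ - a ≥ ρ_c` the point probabilities just under the edge are asymptotically no
smaller than the one at the edge, so moving the edge costs nothing. The condensate itself sits at a
uniform site and misses any fixed finite window with probability tending to one.

Entropies rest on `klDiv_cond`: conditioning on `A` costs exactly `-log ν(A)`. In the fluid phase
Stirling's formula shows that this is `o(L)` at the matching fugacity; in the condensed phase the
event has probability tending to one, by Chebyshev's inequality and the union bound. -/

namespace ZRP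

/-! ### Products of geometric laws: memorylessness and the law of the total -/

section Product

variable {c₀ φ : ℝ}

theorem ratio_nonneg (h0 : 0 ≤ φ) (hφ : φ < c₀) : 0 ≤ φ / c₀ :=
  div_nonneg h0 (h0.trans hφ.le)

theorem ratio_lt_one (h0 : 0 ≤ φ) (hφ : φ < c₀) : φ / c₀ < 1 :=
  (div_lt_one (h0.trans_lt hφ)).2 hφ

theorem fluidMarginal_singleton (h0 : 0 ≤ φ) (hφ : φ < c₀) (k : ℕ) :
    fluidMarginal c₀ φ {k} = ENNReal.ofReal ((1 - φ / c₀) * (φ / c₀) ^ k) := by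
  have hc : 0 < c₀ := h0.trans_lt hφ
  have : c₀ - φ ≠ 0 := (sub_pos.2 hφ).ne'
  rw [fluidMarginal, withDensity_apply _ (MeasurableSet.singleton _), lintegral_singleton,
    Measure.count_singleton, mul_one, fluidPartition]
  congr 1
  field_simp

theorem isProbabilityMeasure_fluidProduct (h0 : 0 ≤ φ) (hφ : φ < c₀) (n : ℕ) :
    IsProbabilityMeasure (fluidProduct c₀ φ n) := by
  have := isProbabilityMeasure_fluidMarginal h0 hφ
  unfold fluidProduct
  infer_instance

theorem fluidProduct_singleton (h0 : 0 ≤ φ) (hφ : φ < c₀) {n : ℕ} (η : Fin n → ℕ) :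
    fluidProduct c₀ φ n {η} = ENNReal.ofReal ((1 - φ / c₀) ^ n * (φ / c₀) ^ ∑ x, η x) := by
  have := isProbabilityMeasure_fluidMarginal h0 hφ
  have hp0 := ratio_nonneg h0 hφ
  have hp1 := ratio_lt_one h0 hφ
  rw [fluidProduct, Measure.pi_singleton]
  simp only [fluidMarginal_singleton h0 hφ]
  rw [← ENNReal.ofReal_prod_of_nonneg fun x _ => mul_nonneg (sub_nonneg.2 hp1.le) (by positivity),
    Finset.prod_mul_distrib, Finset.prod_pow_eq_pow_sum]
  simp

/-- Memoryless property of the product of geometric laws. -/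
theorem fluidProduct_restrict_le (h0 : 0 ≤ φ) (hφ : φ < c₀) {n : ℕ} (s : Fin n → ℕ) :
    (fluidProduct c₀ φ n).restrict {η | s ≤ η} =
      ENNReal.ofReal ((φ / c₀) ^ ∑ x, s x) • (fluidProduct c₀ φ n).map (fun η => η + s) := by
  have hp0 := ratio_nonneg h0 hφ
  have hp1 := ratio_lt_one h0 hφ
  refine Measure.ext_of_singleton fun η => ?_
  rw [Measure.restrict_apply (.of_discrete), Measure.smul_apply,
    Measure.map_apply (.of_discrete) (.of_discrete)]
  by_cases h : s ≤ η
  · have e1 : ({η} ∩ {η | s ≤ η} : Set (Fin n → ℕ)) = {η} := by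
      rw [Set.inter_eq_left]; rintro _ rfl; exact h
    have e2 : (fun η => η + s) ⁻¹' ({η} : Set (Fin n → ℕ)) = {η - s} := by
      ext ζ
      simp only [Set.mem_preimage, Set.mem_singleton_iff]
      constructor
      · rintro rfl; simp
      · rintro rfl; exact tsub_add_cancel_of_le h
    rw [e1, e2, fluidProduct_singleton h0 hφ, fluidProduct_singleton h0 hφ, smul_eq_mul,
      ← ENNReal.ofReal_mul (by positivity)]
    congr 1
    have : ∑ x, η x = ∑ x, s x + ∑ x, (η - s) x := by
      rw [← Finset.sum_add_distrib]
      exact Finset.sum_congr rfl fun x _ => (add_tsub_cancel_of_le (h x)).symm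
    rw [this, pow_add]; ring
  · have e1 : ({η} ∩ {η | s ≤ η} : Set (Fin n → ℕ)) = ∅ := by
      ext ζ; simp only [Set.mem_inter_iff, Set.mem_singleton_iff, Set.mem_empty_iff_false, iff_false]
      rintro ⟨rfl, h'⟩; exact h h'
    have e2 : (fun η => η + s) ⁻¹' ({η} : Set (Fin n → ℕ)) = ∅ := by
      ext ζ
      simp only [Set.mem_preimage, Set.mem_singleton_iff, Set.mem_empty_iff_false, iff_false]
      rintro rfl; exact h (le_add_of_nonneg_left zero_le)
    rw [e1, e2]; simp

/-- The vector `s` enters the right side only through its total, so a limit along scalar shifts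
controls all cylinder events. -/
theorem fluidProduct_real_le_inter (h0 : 0 ≤ φ) (hφ : φ < c₀) {n : ℕ} (s : Fin n → ℕ)
    (D : Set ℕ) :
    (fluidProduct c₀ φ n).real {η | s ≤ η ∧ ∑ x, η x ∈ D} =
      (φ / c₀) ^ (∑ x, s x) *
        (fluidProduct c₀ φ n).real {η | ∑ x, η x + ∑ x, s x ∈ D} := by
  have h := congrArg (fun μ => μ {η : Fin n → ℕ | ∑ x, η x ∈ D}) (fluidProduct_restrict_le h0 hφ s)
  simp only [Measure.restrict_apply (MeasurableSet.of_discrete), Measure.smul_apply,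
    Measure.map_apply (measurable_of_countable _) (MeasurableSet.of_discrete)] at h
  have e1 : {η : Fin n → ℕ | s ≤ η ∧ ∑ x, η x ∈ D} = {η | ∑ x, η x ∈ D} ∩ {η | s ≤ η} := by
    ext η; simp [and_comm]
  have e2 : {η : Fin n → ℕ | ∑ x, η x + ∑ x, s x ∈ D} =
      (fun η => η + s) ⁻¹' {η | ∑ x, η x ∈ D} := by
    ext η; simp [Finset.sum_add_distrib]
  rw [measureReal_def, measureReal_def, e1, e2, h, smul_eq_mul, ENNReal.toReal_mul,
    ENNReal.toReal_ofReal (pow_nonneg (ratio_nonneg h0 hφ) _)]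

theorem fluidProduct_real_coord_le_inter (h0 : 0 ≤ φ) (hφ : φ < c₀) {n : ℕ} (x : Fin n) (k : ℕ)
    (D : Set ℕ) :
    (fluidProduct c₀ φ n).real {η | k ≤ η x ∧ ∑ y, η y ∈ D} =
      (φ / c₀) ^ k * (fluidProduct c₀ φ n).real {η | ∑ y, η y + k ∈ D} := by
  have h := fluidProduct_real_le_inter h0 hφ (Pi.single x k) D
  have e : ∀ η : Fin n → ℕ, Pi.single x k ≤ η ↔ k ≤ η x := fun η => by
    constructor
    · intro h; simpa using h x
    · intro h y
      by_cases hy : y = x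
      · subst hy; simpa using h
      · simp [hy]
  simpa [e] using h

/-- Union bound over sites, keeping the constraint on the total: the event may be rare, so the bound
must remain comparable with its probability. -/
theorem fluidProduct_real_exists_lt_inter (h0 : 0 ≤ φ) (hφ : φ < c₀) (n R : ℕ) (D : Set ℕ) :
    (fluidProduct c₀ φ n).real {η | (∃ x, R < η x) ∧ ∑ y, η y ∈ D} ≤
      n * ((φ / c₀) ^ (R + 1) * (fluidProduct c₀ φ n).real {η | ∑ y, η y + (R + 1) ∈ D}) := by
  have := isProbabilityMeasure_fluidProduct h0 hφ n
  have e : {η : Fin n → ℕ | (∃ x, R < η x) ∧ ∑ y, η y ∈ D} =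
      ⋃ x, {η | R + 1 ≤ η x ∧ ∑ y, η y ∈ D} := by
    ext η; simp
  rw [e]
  refine (measureReal_iUnion_fintype_le _).trans ?_
  simp only [fluidProduct_real_coord_le_inter h0 hφ]
  simp

theorem ncard_sum_eq (n m : ℕ) : {η : Fin n → ℕ | ∑ x, η x = m}.ncard = n.multichoose m := by
  have h := Finset.card_finsuppAntidiag_nat_eq_multichoose
    (s := (Finset.univ : Finset (Fin n))) m
  rw [Finset.card_fin] at h
  rw [← h, ← Set.ncard_coe_finset,
    ← Set.ncard_image_of_injective _ (DFunLike.coe_injective (F := Fin n →₀ ℕ))]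
  congr 1
  ext η
  simp only [Set.mem_ofPred_eq, Set.mem_image, SetLike.mem_coe, Finset.mem_finsuppAntidiag,
    Finset.subset_univ, and_true]
  constructor
  · intro h
    exact ⟨Finsupp.equivFunOnFinite.symm η, by simpa using h, by simp⟩
  · rintro ⟨ζ, h, rfl⟩
    simpa using h

theorem finite_sum_eq (n m : ℕ) : {η : Fin n → ℕ | ∑ x, η x = m}.Finite := by
  have e : {η : Fin n → ℕ | ∑ x, η x = m} = (Finset.Nat.antidiagonalTuple n m : Set (Fin n → ℕ)) := by
    ext η; simp [Finset.Nat.mem_antidiagonalTuple]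
  rw [e]
  exact Finset.finite_toSet _

theorem fluidProduct_real_sum_eq (h0 : 0 ≤ φ) (hφ : φ < c₀) (n m : ℕ) :
    (fluidProduct c₀ φ n).real {η | ∑ x, η x = m} =
      n.multichoose m * ((1 - φ / c₀) ^ n * (φ / c₀) ^ m) := by
  have hp0 := ratio_nonneg h0 hφ
  have hp1 := ratio_lt_one h0 hφ
  have := isProbabilityMeasure_fluidProduct h0 hφ n
  have hf := finite_sum_eq n m
  rw [← ncard_sum_eq, Set.ncard_eq_toFinset_card _ hf, ← nsmul_eq_mul, ← Finset.sum_const]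
  nth_rw 1 [← hf.coe_toFinset]
  rw [← sum_measureReal_singleton]
  refine Finset.sum_congr rfl fun η hη => ?_
  have hη : ∑ x, η x = m := by simpa using hη
  rw [measureReal_def, fluidProduct_singleton h0 hφ, hη, ENNReal.toReal_ofReal]
  have := sub_nonneg.2 hp1.le
  positivity

end Product

/-! ### Convergence of point masses on countable spaces -/

section Countable

variable {E : Type*} [Countable E] [MeasurableSpace E] [MeasurableSingletonClass E]

theorem hasSum_real_singleton (ν : Measure E) [IsProbabilityMeasure ν] :
    HasSum (fun x => ν.real {x}) 1 := by
  have h : ∫ _, (1 : ℝ) ∂ν = ∑' x, ν.real {x} • (1 : ℝ) :=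
    integral_countable (integrable_const 1)
  simp only [integral_const, probReal_univ, smul_eq_mul, mul_one] at h
  -- A divergent `tsum` has the default value `0`, whereas this one equals `1`.
  have hs : Summable fun x => ν.real {x} := by
    by_contra hs
    rw [tsum_eq_zero_of_not_summable hs] at h
    exact one_ne_zero h
  rw [h]
  exact hs.hasSum

theorem integral_eq_sum_add_setIntegral_compl (ν : Measure E) [IsProbabilityMeasure ν]
    (F : Finset E) {g : E → ℝ} {C : ℝ} (hg : ∀ x, |g x| ≤ C) :
    |∫ x, g x ∂ν - ∑ x ∈ F, ν.real {x} * g x| ≤ C * (1 - ∑ x ∈ F, ν.real {x}) := by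
  have hi : Integrable g ν :=
    Integrable.of_bound (measurable_of_countable g).aestronglyMeasurable C (ae_of_all _ hg)
  have hF : MeasurableSet (F : Set E) := F.measurableSet
  rw [← integral_add_compl hF hi, setIntegral_finset _ hi.integrableOn]
  simp only [smul_eq_mul, add_sub_cancel_left]
  have h := norm_setIntegral_le_of_norm_le_const (μ := ν) (s := (F : Set E)ᶜ) (f := g) (C := C)
    (measure_lt_top _ _) (fun x _ => hg x)
  rwa [Real.norm_eq_abs, probReal_compl_eq_one_sub hF, ← sum_measureReal_singleton] at h

/-- On a countable discrete space, convergence of the point masses to those of a probability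
measure implies convergence of the integrals of bounded functions. -/
theorem tendsto_integral_of_tendsto_singleton {μ : ℕ → Measure E} {ν : Measure E}
    [IsProbabilityMeasure ν] (hμ : ∀ᶠ n in atTop, IsProbabilityMeasure (μ n))
    (h : ∀ x, Tendsto (fun n => (μ n).real {x}) atTop (𝓝 (ν.real {x}))) {g : E → ℝ} {C : ℝ}
    (hg : ∀ x, |g x| ≤ C) :
    Tendsto (fun n => ∫ x, g x ∂(μ n)) atTop (𝓝 (∫ x, g x ∂ν)) := by
  rw [Metric.tendsto_nhds]
  intro ε hε
  have hC : 0 ≤ C := by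
    obtain ⟨x⟩ : Nonempty E := ν.nonempty_of_neZero
    exact (abs_nonneg _).trans (hg x)
  have hl : Tendsto (fun F : Finset E => C * (1 - ∑ x ∈ F, ν.real {x})) atTop (𝓝 0) := by
    have := ((hasSum_real_singleton ν).const_sub 1).const_mul C
    simpa using this
  -- No tightness is assumed: a finite set carrying almost all of `ν` eventually carries almost all
  -- of `μ n`, because the finitely many masses converge and the totals are `1`.
  obtain ⟨F, hF⟩ := (hl.eventually (gt_mem_nhds (show 0 < ε / 4 by positivity))).exists
  have t1 : Tendsto (fun n => C * (1 - ∑ x ∈ F, (μ n).real {x})) atTop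
      (𝓝 (C * (1 - ∑ x ∈ F, ν.real {x}))) :=
    ((tendsto_finsetSum F fun x _ => h x).const_sub 1).const_mul C
  have t2 : Tendsto (fun n => ∑ x ∈ F, (μ n).real {x} * g x) atTop
      (𝓝 (∑ x ∈ F, ν.real {x} * g x)) :=
    tendsto_finsetSum F fun x _ => (h x).mul_const _
  filter_upwards [hμ, t1.eventually (gt_mem_nhds hF),
    Metric.tendsto_nhds.1 t2 (ε / 4) (by positivity)] with n hn h1 h2
  have a1 := integral_eq_sum_add_setIntegral_compl (μ n) F hg
  have a2 := integral_eq_sum_add_setIntegral_compl ν F hg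
  rw [Real.dist_eq] at h2 ⊢
  rw [abs_lt] at h2 ⊢
  rw [abs_le] at a1 a2
  constructor <;> linarith

end Countable

/-! ### From tail probabilities to weak convergence -/

section Cylinder

/-- Inclusion-exclusion, one site at a time: being equal to `s a` is being at least `s a` but not at
least `s a + 1`. Each site of `A` thus turns the tail limit into a difference and contributes a
factor `1 - q`. -/
theorem tendsto_real_cylinder {μ : (n : ℕ) → Measure (Fin n → ℕ)} [∀ n, IsFiniteMeasure (μ n)]
    {q : ℝ} {S : Finset ℕ}
    (h : ∀ s : ℕ → ℕ, Tendsto (fun n => (μ n).real {η | ∀ i ∈ S, s i ≤ extendByZero η i}) atTop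
      (𝓝 (q ^ ∑ i ∈ S, s i)))
    (A : Finset ℕ) (hA : A ⊆ S) (s : ℕ → ℕ) :
    Tendsto (fun n => (μ n).real {η | (∀ i ∈ A, extendByZero η i = s i) ∧
      ∀ i ∈ S, s i ≤ extendByZero η i}) atTop (𝓝 ((1 - q) ^ A.card * q ^ ∑ i ∈ S, s i)) := by
  induction A using Finset.induction_on generalizing s with
  | empty => simpa using h s
  | insert a A ha ih =>
    have haS : a ∈ S := hA (Finset.mem_insert_self _ _)
    have hAS : A ⊆ S := (Finset.subset_insert _ _).trans hA
    set s' := Function.update s a (s a + 1) with hs'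
    have hle : ∀ i, s i ≤ s' i := fun i => by
      by_cases hi : i = a
      · subst hi; simp [hs']
      · simp [hs', hi]
    have hsA : ∀ i ∈ A, s' i = s i := fun i hi => by
      have : i ≠ a := by rintro rfl; exact ha hi
      simp [hs', this]
    have hsum : ∑ i ∈ S, s' i = ∑ i ∈ S, s i + 1 := by
      rw [hs', Finset.sum_update_of_mem haS, ← Finset.add_sum_erase _ _ haS,
        Finset.sdiff_singleton_eq_erase]
      ring
    have key : ∀ n, (μ n).real {η | (∀ i ∈ insert a A, extendByZero η i = s i) ∧
        ∀ i ∈ S, s i ≤ extendByZero η i} =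
        (μ n).real {η | (∀ i ∈ A, extendByZero η i = s i) ∧ ∀ i ∈ S, s i ≤ extendByZero η i} -
        (μ n).real {η | (∀ i ∈ A, extendByZero η i = s' i) ∧
          ∀ i ∈ S, s' i ≤ extendByZero η i} := by
      intro n
      rw [← measureReal_sdiff _ (MeasurableSet.of_discrete)]
      · congr 1
        ext η
        simp only [Finset.mem_insert, forall_eq_or_imp, Set.mem_ofPred_eq, Set.mem_sdiff, not_and,
          not_forall, exists_prop]
        constructor
        · rintro ⟨⟨h1, h2⟩, h3⟩
          refine ⟨⟨h2, h3⟩, fun _ => ⟨a, haS, ?_⟩⟩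
          simp [hs', h1]
        · rintro ⟨⟨h2, h3⟩, h4⟩
          refine ⟨⟨?_, h2⟩, h3⟩
          obtain ⟨i, hi, hlt⟩ := h4 fun i hi => (h2 i hi).trans (hsA i hi).symm
          by_cases hia : i = a
          · subst hia
            have := h3 i hi
            simp only [hs', Function.update_self] at hlt
            omega
          · simp only [hs', Function.update_of_ne hia] at hlt
            exact absurd (h3 i hi) hlt
      · rintro η ⟨h1, h2⟩
        exact ⟨fun i hi => (h1 i hi).trans (hsA i hi), fun i hi => (hle i).trans (h2 i hi)⟩
    simp only [key]
    have := (ih hAS s).sub (ih hAS s')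
    rw [hsum] at this
    rw [Finset.card_insert_of_notMem ha]
    convert this using 2
    ring

/-- A cylinder function factors through the countable discrete space `S → ℕ`, where convergence of
point masses suffices; these come from tails by `tendsto_real_cylinder`. -/
theorem convergesWeakly_of_tendsto_tail {c₀ φ : ℝ} (h0 : 0 ≤ φ) (hφ : φ < c₀)
    {μ : (n : ℕ) → Measure (Fin n → ℕ)} [∀ n, IsFiniteMeasure (μ n)]
    (hμ : ∀ᶠ n in atTop, IsProbabilityMeasure (μ n))
    (h : ∀ (S : Finset ℕ) (s : ℕ → ℕ),
      Tendsto (fun n => (μ n).real {η | ∀ i ∈ S, s i ≤ extendByZero η i}) atTop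
        (𝓝 ((φ / c₀) ^ ∑ i ∈ S, s i))) :
    ConvergesWeakly μ (fluidInfinite c₀ φ) := by
  have := isProbabilityMeasure_fluidMarginal h0 hφ
  have hp0 := ratio_nonneg h0 hφ
  have hp1 := ratio_lt_one h0 hφ
  rintro S f hf ⟨C, hC⟩
  set g : (S → ℕ) → ℝ := fun y => f fun i => if hi : i ∈ S then y ⟨i, hi⟩ else 0 with hg
  have hfg : ∀ η, f η = g (S.restrict η) := fun η => hf fun i hi => by
    have hi : i ∈ S := hi
    simp [hi]
  have hres : ∀ n, Measurable fun η : Fin n → ℕ => S.restrict (extendByZero η) :=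
    fun n => measurable_of_countable _
  have e1 : ∀ n, ∫ η, f (extendByZero η) ∂(μ n) =
      ∫ y, g y ∂((μ n).map fun η => S.restrict (extendByZero η)) := fun n => by
    rw [integral_map (hres n).aemeasurable (measurable_of_countable g).aestronglyMeasurable]
    exact integral_congr_ae (ae_of_all _ fun η => hfg _)
  have e2 : ∫ η, f η ∂(fluidInfinite c₀ φ) =
      ∫ y, g y ∂(Measure.pi fun _ : S => fluidMarginal c₀ φ) := by
    rw [← Measure.infinitePi_map_restrict (μ := fun _ : ℕ => fluidMarginal c₀ φ), integral_map
      (Finset.measurable_restrict S).aemeasurable (measurable_of_countable g).aestronglyMeasurable]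
    exact integral_congr_ae (ae_of_all _ fun η => hfg _)
  simp only [e1, e2]
  refine tendsto_integral_of_tendsto_singleton ?_ (fun y => ?_) (fun y => hC _)
  · filter_upwards [hμ] with n hn
    exact Measure.isProbabilityMeasure_map (hres n).aemeasurable
  · set s : ℕ → ℕ := fun i => if hi : i ∈ S then y ⟨i, hi⟩ else 0 with hs
    have t := tendsto_real_cylinder (h S) S subset_rfl s
    have e3 : (Measure.pi fun _ : S => fluidMarginal c₀ φ).real {y} =
        (1 - φ / c₀) ^ S.card * (φ / c₀) ^ ∑ i ∈ S, s i := by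
      rw [measureReal_def, Measure.pi_singleton]
      simp only [fluidMarginal_singleton h0 hφ]
      have hy : ∀ i : S, y i = s i := fun i => by simp [hs]
      have e4 : ∀ k : ℕ, (ENNReal.ofReal ((1 - φ / c₀) * (φ / c₀) ^ k)).toReal =
          (1 - φ / c₀) * (φ / c₀) ^ k := fun k =>
        ENNReal.toReal_ofReal (mul_nonneg (sub_nonneg.2 hp1.le) (by positivity))
      simp only [ENNReal.toReal_prod, hy, e4]
      rw [Finset.prod_coe_sort S fun i => (1 - φ / c₀) * (φ / c₀) ^ s i,
        Finset.prod_mul_distrib, Finset.prod_pow_eq_pow_sum, Finset.prod_const]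
    rw [e3]
    refine t.congr fun n => ?_
    rw [map_measureReal_apply (hres n) (MeasurableSet.singleton _)]
    congr 1
    ext η
    simp only [Set.mem_ofPred_eq, Set.mem_preimage, Set.mem_singleton_iff, funext_iff,
      Finset.restrict, Subtype.forall]
    constructor
    · rintro ⟨h1, -⟩ i hi
      rw [h1 i hi]; simp [hs, hi]
    · intro h1
      have h2 : ∀ i ∈ S, extendByZero η i = s i := fun i hi => by simp [hs, hi, h1 i hi]
      exact ⟨h2, fun i hi => (h2 i hi).ge⟩

end Cylinder

/-! ### Conditioning on the total and truncating at `R` -/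

section Truncation

variable {c₀ φ q : ℝ} {D : ℕ → Set ℕ} {R : ℕ → ℕ}

theorem tail_eq_ge {S : Finset ℕ} {n : ℕ} (hS : ∀ i ∈ S, i < n) (s : ℕ → ℕ) :
    {η : Fin n → ℕ | ∀ i ∈ S, s i ≤ extendByZero η i} =
      {η | (fun x : Fin n => if (x : ℕ) ∈ S then s x else 0) ≤ η} := by
  ext η
  simp only [Set.mem_ofPred_eq, Pi.le_def]
  constructor
  · intro h x
    split_ifs with hx
    · simpa [extendByZero] using h x hx
    · exact Nat.zero_le _
  · intro h i hi
    have := h ⟨i, hS i hi⟩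
    simpa [extendByZero, hS i hi, hi] using this

theorem sum_fin_ite_mem {S : Finset ℕ} {n : ℕ} (hS : ∀ i ∈ S, i < n) (s : ℕ → ℕ) :
    ∑ x : Fin n, (if (x : ℕ) ∈ S then s x else 0) = ∑ i ∈ S, s i := by
  rw [Fin.sum_univ_eq_sum_range (fun i => if i ∈ S then s i else 0) n, Finset.sum_ite_mem,
    Finset.inter_eq_right.2 fun i hi => Finset.mem_range.2 (hS i hi)]

/-- The case `s = 0` of the hypothesis says that `P/P` tends to `1`, which excludes `P = 0` since
`0/0 = 0`. -/
theorem eventually_real_sum_mem_pos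
    (h1 : ∀ s : ℕ, Tendsto (fun n => (φ / c₀) ^ s *
      (fluidProduct c₀ φ n).real {η | ∑ x, η x + s ∈ D n} /
        (fluidProduct c₀ φ n).real {η | ∑ x, η x ∈ D n}) atTop (𝓝 (q ^ s))) :
    ∀ᶠ n in atTop, 0 < (fluidProduct c₀ φ n).real {η | ∑ x, η x ∈ D n} := by
  have := h1 0
  simp only [pow_zero, one_mul, add_zero] at this
  filter_upwards [this.eventually_ne one_ne_zero] with n hn
  refine measureReal_nonneg.lt_of_ne fun h => hn ?_
  rw [← h, div_zero]

/-- Imposing the bound `R` removes at most the event that some site exceeds it, and `h2` makes that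
negligible relative to the constraint on the total. -/
theorem tendsto_real_truncation_inter (h0 : 0 ≤ φ) (hφ : φ < c₀)
    (h2 : Tendsto (fun n => n * ((φ / c₀) ^ (R n + 1) *
      (fluidProduct c₀ φ n).real {η | ∑ x, η x + (R n + 1) ∈ D n}) /
        (fluidProduct c₀ φ n).real {η | ∑ x, η x ∈ D n}) atTop (𝓝 0))
    {T : (n : ℕ) → Set (Fin n → ℕ)} {l : ℝ}
    (hT : Tendsto (fun n => (fluidProduct c₀ φ n).real {η | η ∈ T n ∧ ∑ x, η x ∈ D n} /
        (fluidProduct c₀ φ n).real {η | ∑ x, η x ∈ D n}) atTop (𝓝 l)) :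
    Tendsto (fun n => (fluidProduct c₀ φ n).real
      ({η | ∑ x, η x ∈ D n ∧ ∀ x, η x ≤ R n} ∩ T n) /
        (fluidProduct c₀ φ n).real {η | ∑ x, η x ∈ D n}) atTop (𝓝 l) := by
  have := isProbabilityMeasure_fluidProduct h0 hφ
  refine tendsto_of_tendsto_of_tendsto_of_le_of_le (by simpa using hT.sub h2) hT
    (fun n => ?_) (fun n => ?_)
  · simp only
    rw [← sub_div]
    gcongr
    rw [sub_le_iff_le_add]
    refine le_trans ?_ (add_le_add_right
      (fluidProduct_real_exists_lt_inter h0 hφ n (R n) (D n)) _)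
    refine le_trans (measureReal_mono ?_) (measureReal_union_le _ _)
    rintro η ⟨hη, hD⟩
    by_cases h : ∀ x, η x ≤ R n
    · exact Or.inl ⟨⟨hD, h⟩, hη⟩
    · push Not at h
      exact Or.inr ⟨h, hD⟩
  · refine div_le_div_of_nonneg_right (measureReal_mono ?_) measureReal_nonneg
    rintro η ⟨⟨hD, -⟩, hη⟩
    exact ⟨hη, hD⟩

theorem tendsto_real_truncation (h0 : 0 ≤ φ) (hφ : φ < c₀)
    (h1 : ∀ s : ℕ, Tendsto (fun n => (φ / c₀) ^ s *
      (fluidProduct c₀ φ n).real {η | ∑ x, η x + s ∈ D n} /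
        (fluidProduct c₀ φ n).real {η | ∑ x, η x ∈ D n}) atTop (𝓝 (q ^ s)))
    (h2 : Tendsto (fun n => n * ((φ / c₀) ^ (R n + 1) *
      (fluidProduct c₀ φ n).real {η | ∑ x, η x + (R n + 1) ∈ D n}) /
        (fluidProduct c₀ φ n).real {η | ∑ x, η x ∈ D n}) atTop (𝓝 0)) :
    Tendsto (fun n => (fluidProduct c₀ φ n).real {η | ∑ x, η x ∈ D n ∧ ∀ x, η x ≤ R n} /
        (fluidProduct c₀ φ n).real {η | ∑ x, η x ∈ D n}) atTop (𝓝 1) := by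
  have := tendsto_real_truncation_inter h0 hφ h2 (T := fun _ => Set.univ) (l := 1)
    (by simpa using h1 0)
  simpa using this

/-- Equivalence of ensembles for the product of geometric laws conditioned on the total number of
particles and on a bound for the single occupation numbers. -/
theorem convergesWeakly_cond (h0 : 0 ≤ φ) (hφ : φ < c₀) {ψ : ℝ} (hψ0 : 0 ≤ ψ) (hψ : ψ < c₀)
    (h1 : ∀ s : ℕ, Tendsto (fun n => (φ / c₀) ^ s *
      (fluidProduct c₀ φ n).real {η | ∑ x, η x + s ∈ D n} /
        (fluidProduct c₀ φ n).real {η | ∑ x, η x ∈ D n}) atTop (𝓝 ((ψ / c₀) ^ s)))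
    (h2 : Tendsto (fun n => n * ((φ / c₀) ^ (R n + 1) *
      (fluidProduct c₀ φ n).real {η | ∑ x, η x + (R n + 1) ∈ D n}) /
        (fluidProduct c₀ φ n).real {η | ∑ x, η x ∈ D n}) atTop (𝓝 0)) :
    (∀ᶠ n in atTop, IsProbabilityMeasure
      (cond (fluidProduct c₀ φ n) {η | ∑ x, η x ∈ D n ∧ ∀ x, η x ≤ R n})) ∧
    ConvergesWeakly
      (fun n => cond (fluidProduct c₀ φ n) {η | ∑ x, η x ∈ D n ∧ ∀ x, η x ≤ R n})
      (fluidInfinite c₀ ψ) := by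
  have := isProbabilityMeasure_fluidProduct h0 hφ
  have ht := tendsto_real_truncation h0 hφ h1 h2
  have hpos := eventually_real_sum_mem_pos h1
  have hprob : ∀ᶠ n in atTop, IsProbabilityMeasure
      (cond (fluidProduct c₀ φ n) {η | ∑ x, η x ∈ D n ∧ ∀ x, η x ≤ R n}) := by
    filter_upwards [ht.eventually_ne one_ne_zero] with n hn
    refine cond_isProbabilityMeasure fun h => hn ?_
    rw [measureReal_def, h]; simp
  refine ⟨hprob, convergesWeakly_of_tendsto_tail hψ0 hψ hprob fun S s => ?_⟩
  have hT : Tendsto (fun n => (fluidProduct c₀ φ n).real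
      {η | η ∈ {η : Fin n → ℕ | ∀ i ∈ S, s i ≤ extendByZero η i} ∧ ∑ x, η x ∈ D n} /
        (fluidProduct c₀ φ n).real {η | ∑ x, η x ∈ D n}) atTop
      (𝓝 ((ψ / c₀) ^ ∑ i ∈ S, s i)) := by
    refine (h1 (∑ i ∈ S, s i)).congr' ?_
    -- Beyond the largest site of `S`, the extension by zero is invisible to `S`.
    filter_upwards [eventually_gt_atTop (S.sup id)] with n hn
    have hS : ∀ i ∈ S, i < n := fun i hi => (Finset.le_sup (f := id) hi).trans_lt hn
    have hmem : ∀ η : Fin n → ℕ, (∀ i ∈ S, s i ≤ extendByZero η i) ↔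
        (fun x : Fin n => if (x : ℕ) ∈ S then s x else 0) ≤ η :=
      Set.ext_iff.1 (tail_eq_ge hS s)
    simp only [hmem]
    have := fluidProduct_real_le_inter h0 hφ
      (fun x : Fin n => if (x : ℕ) ∈ S then s x else 0) (D n)
    rw [sum_fin_ite_mem hS] at this
    rw [← this]
  have := (tendsto_real_truncation_inter h0 hφ h2 hT).div ht one_ne_zero
  rw [div_one] at this
  refine this.congr' ?_
  filter_upwards [hpos] with n hn
  rw [Pi.div_apply, div_div_div_cancel_right₀ hn.ne', div_eq_inv_mul]
  simp only [measureReal_def, cond_apply (MeasurableSet.of_discrete), ENNReal.toReal_mul,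
    ENNReal.toReal_inv]

end Truncation

/-! ### Conditional measures and their relative entropy -/

section Conditioning

/-- The density of `cond ν A` is the constant `(ν A)⁻¹` on `A`, so the log-likelihood ratio is
almost surely constant and the entropy is that constant. -/
theorem klDiv_cond {α : Type*} [MeasurableSpace α] (ν : Measure α) [IsProbabilityMeasure ν]
    {A : Set α} (hA : MeasurableSet A) (h : ν A ≠ 0) :
    klDiv (cond ν A) ν = ENNReal.ofReal (-Real.log (ν.real A)) := by
  have := cond_isProbabilityMeasure h
  have hac : cond ν A ≪ ν := cond_absolutelyContinuous
  have e : cond ν A = ν.withDensity (A.indicator fun _ => (ν A)⁻¹) := by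
    rw [withDensity_indicator hA, withDensity_const, ProbabilityTheory.cond]
  have hrn : (cond ν A).rnDeriv ν =ᵐ[ν] A.indicator fun _ => (ν A)⁻¹ := by
    nth_rw 1 [e]
    exact Measure.rnDeriv_withDensity ν (measurable_const.indicator hA)
  have hllr : llr (cond ν A) ν =ᵐ[cond ν A] fun _ => -Real.log (ν.real A) := by
    filter_upwards [hac.ae_le hrn, ae_cond_mem hA] with x hx hxA
    rw [llr, hx, Set.indicator_of_mem hxA, ENNReal.toReal_inv, Real.log_inv, measureReal_def]
  have hint : Integrable (llr (cond ν A) ν) (cond ν A) :=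
    (integrable_congr hllr).2 (integrable_const _)
  rw [klDiv_of_ac_of_integrable hac hint, integral_congr_ae hllr]
  simp

variable {α β : Type*} [MeasurableSpace α] [MeasurableSpace β]

/-- Normalization cancels the constant `K`, so partition functions never need to be computed. -/
theorem cond_map_eq_cond {μ : Measure α} {ν : Measure β} {A : Set α} {B : Set β} {g : α → β}
    (hg : Measurable g) {K : ℝ≥0∞} (hK : K ≠ 0) (hK' : K ≠ ∞)
    (h : (μ.restrict A).map g = K • ν.restrict B) : (cond μ A).map g = cond ν B := by
  have hA : μ A = K * ν B := by
    have := congrArg (fun m => m Set.univ) h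
    simpa [Measure.map_apply hg MeasurableSet.univ] using this
  rw [ProbabilityTheory.cond, ProbabilityTheory.cond, Measure.map_smul, h, hA, smul_smul,
    ENNReal.mul_inv (Or.inl hK) (Or.inl hK'), mul_right_comm, ENNReal.inv_mul_cancel hK hK',
    one_mul]

theorem restrict_singleton_of_mem [MeasurableSingletonClass α] (μ : Measure α) {A : Set α} {a : α}
    (ha : a ∈ A) : μ.restrict A {a} = μ {a} := by
  rw [Measure.restrict_apply (MeasurableSet.singleton a),
    Set.inter_eq_left.2 (Set.singleton_subset_iff.2 ha)]

theorem restrict_singleton_of_notMem [MeasurableSingletonClass α] (μ : Measure α) {A : Set α}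
    {a : α} (ha : a ∉ A) : μ.restrict A {a} = 0 := by
  rw [Measure.restrict_apply (MeasurableSet.singleton a), Set.singleton_inter_eq_empty.2 ha,
    measure_empty]

end Conditioning

/-! ### Reduction of the conditioned measures to geometric products -/

section Weights

variable {c₀ c₁ : ℝ}

theorem weightMeasure_singleton (R : ℕ) {L : ℕ} (η : Fin L → ℕ) :
    weightMeasure c₀ c₁ R L {η} = ENNReal.ofReal (∏ x, weight c₀ c₁ R (η x)) := by
  rw [weightMeasure, withDensity_apply _ (MeasurableSet.singleton _), lintegral_singleton,
    Measure.count_singleton, mul_one]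

/-- The weight measure may have infinite mass; finiteness on a shell of fixed particle number is
what lets iterated conditioning collapse. -/
theorem weightMeasure_config_ne_top (R L N : ℕ) : weightMeasure c₀ c₁ R L (config L N) ≠ ∞ := by
  have hf : (config L N).Finite := finite_sum_eq L N
  rw [← hf.coe_toFinset, ← sum_measure_singleton]
  exact ENNReal.sum_ne_top.2 fun η _ => by
    rw [weightMeasure_singleton]; exact ENNReal.ofReal_ne_top

theorem cond_canonical (R L N : ℕ) (E : Set (Fin L → ℕ)) :
    cond (canonical c₀ c₁ R L N) E = cond (weightMeasure c₀ c₁ R L) (config L N ∩ E) :=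
  cond_cond_eq_cond_inter' .of_discrete .of_discrete (weightMeasure_config_ne_top R L N)

theorem quasiStationary_eq (R L N m : ℕ) :
    quasiStationary c₀ c₁ R L N m = cond (weightMeasure c₀ c₁ R L) (configWith R L N m) := by
  rw [quasiStationary, cond_canonical, Set.inter_eq_right.2 fun η hη => hη.1]

theorem prod_weight_of_le {ι : Type*} [Fintype ι] {R : ℕ} {η : ι → ℕ} (h : ∀ x, η x ≤ R) :
    ∏ x, weight c₀ c₁ R (η x) = (c₀ ^ ∑ x, η x)⁻¹ := by
  rw [← Finset.prod_pow_eq_pow_sum, ← Finset.prod_inv_distrib]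
  exact Finset.prod_congr rfl fun x _ => by rw [weight_eq, if_pos (h x)]

theorem configWith_zero (R L N : ℕ) :
    configWith R L N 0 = {η | ∑ x, η x ∈ ({N} : Set ℕ) ∧ ∀ x, η x ≤ R} := by
  ext η
  simp [configWith, Finset.filter_eq_empty_iff]

/-- Both sides are uniform on the same set: the weight is constantly `c₀^(-N)` there, and the
product measure depends only on the total. Hence the fugacity is free, as long as it gives that
total positive mass. -/
theorem quasiStationary_zero_eq {φ : ℝ} (h0 : 0 ≤ φ) (hφ : φ < c₀) {R L N : ℕ}
    (hN : (φ / c₀) ^ N ≠ 0) :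
    quasiStationary c₀ c₁ R L N 0 =
      cond (fluidProduct c₀ φ L) {η | ∑ x, η x ∈ ({N} : Set ℕ) ∧ ∀ x, η x ≤ R} := by
  have hc : 0 < c₀ := h0.trans_lt hφ
  have hp1 : 0 < 1 - φ / c₀ := sub_pos.2 (ratio_lt_one h0 hφ)
  have hp0 : 0 < (φ / c₀) ^ N := (pow_nonneg (ratio_nonneg h0 hφ) N).lt_of_ne hN.symm
  set t : ℝ := (c₀ ^ N)⁻¹ / ((1 - φ / c₀) ^ L * (φ / c₀) ^ N) with ht
  have htpos : 0 < t := by positivity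
  rw [quasiStationary_eq, configWith_zero]
  nth_rw 1 [← Measure.map_id (μ := cond _ _)]
  refine cond_map_eq_cond measurable_id (K := ENNReal.ofReal t) (by simpa using htpos)
    ENNReal.ofReal_ne_top ?_
  rw [Measure.map_id]
  refine Measure.ext_of_singleton fun η => ?_
  rw [Measure.smul_apply, smul_eq_mul]
  by_cases h : η ∈ {η : Fin L → ℕ | ∑ x, η x ∈ ({N} : Set ℕ) ∧ ∀ x, η x ≤ R}
  · rw [restrict_singleton_of_mem _ h, restrict_singleton_of_mem _ h, weightMeasure_singleton,
      fluidProduct_singleton h0 hφ, prod_weight_of_le h.2, show ∑ x, η x = N from h.1,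
      ← ENNReal.ofReal_mul htpos.le, ht, div_mul_cancel₀ _ (by positivity)]
  · rw [restrict_singleton_of_notMem _ h, restrict_singleton_of_notMem _ h, mul_zero]

/-- Configurations with `N` particles in which `y` is the only site with more than `R` particles. -/
def condensateAt (R n N : ℕ) (y : Fin (n + 1)) : Set (Fin (n + 1) → ℕ) :=
  {η | ∑ x, η x = N ∧ R < η y ∧ ∀ x, η (y.succAbove x) ≤ R}

/-- Background configurations that leave more than `R` particles for the condensate. -/
def backgroundConfig (R n N : ℕ) : Set (Fin n → ℕ) :=
  {ξ | ∑ x, ξ x ∈ {m | m + R < N} ∧ ∀ x, ξ x ≤ R}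

/-- Completion of a background configuration by a condensate on site `y`. -/
def insertCondensate {n : ℕ} (N : ℕ) (y : Fin (n + 1)) (ξ : Fin n → ℕ) : Fin (n + 1) → ℕ :=
  y.insertNth (α := fun _ => ℕ) (N - ∑ x, ξ x) ξ

theorem insertCondensate_mem {R n N : ℕ} (y : Fin (n + 1)) {ξ : Fin n → ℕ}
    (h : ξ ∈ backgroundConfig R n N) : insertCondensate N y ξ ∈ condensateAt R n N y := by
  have h1 : ∑ x, ξ x + R < N := h.1
  refine ⟨?_, ?_, fun x => ?_⟩
  · rw [Fin.sum_univ_succAbove _ y]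
    simp only [insertCondensate, Fin.insertNth_apply_same, Fin.insertNth_apply_succAbove]
    omega
  · simp only [insertCondensate, Fin.insertNth_apply_same]
    omega
  · simpa only [insertCondensate, Fin.insertNth_apply_succAbove] using h.2 x

theorem insertCondensate_preimage {R n N : ℕ} {y : Fin (n + 1)} {η : Fin (n + 1) → ℕ}
    (h : η ∈ condensateAt R n N y) :
    (y.removeNth η : Fin n → ℕ) ∈ backgroundConfig R n N ∧
      insertCondensate N y ⁻¹' {η} = {y.removeNth η} := by
  obtain ⟨h1, h2, h3⟩ := h
  rw [Fin.sum_univ_succAbove _ y] at h1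
  have hs : ∑ x, (y.removeNth η : Fin n → ℕ) x = ∑ x, η (y.succAbove x) := rfl
  refine ⟨⟨?_, h3⟩, ?_⟩
  · simp only [Set.mem_ofPred_eq, hs]; omega
  · ext ξ
    simp only [Set.mem_preimage, Set.mem_singleton_iff, insertCondensate,
      Fin.insertNth_eq_iff]
    constructor
    · exact fun h => h.2
    · rintro rfl
      exact ⟨by rw [hs]; omega, rfl⟩

theorem weightMeasure_restrict_condensateAt (hc₁ : 0 < c₁) (hc : c₁ < c₀) (R n N : ℕ) :
    ∃ K : ℝ≥0∞, K ≠ 0 ∧ K ≠ ∞ ∧ ∀ y : Fin (n + 1),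
      (weightMeasure c₀ c₁ R (n + 1)).restrict (condensateAt R n N y) =
        K • ((fluidProduct c₀ c₁ n).restrict (backgroundConfig R n N)).map
          (insertCondensate N y) := by
  have hc₀ : 0 < c₀ := hc₁.trans hc
  have hp1 : 0 < 1 - c₁ / c₀ := sub_pos.2 (ratio_lt_one hc₁.le hc)
  -- With background total `m` the weight is `c₀^(-R) c₁^(-(N-m-R)) c₀^(-m)`, that is `c₀^(-R)
  -- c₁^(-(N-R)) (c₁/c₀)^m`; dividing by the product mass leaves a constant independent of `m` and
  -- of `y`.
  set t : ℝ := (c₀ ^ R)⁻¹ * (c₁ ^ (N - R))⁻¹ / (1 - c₁ / c₀) ^ n with ht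
  have htpos : 0 < t := by positivity
  refine ⟨ENNReal.ofReal t, by simpa using htpos, ENNReal.ofReal_ne_top, fun y => ?_⟩
  refine Measure.ext_of_singleton fun η => ?_
  rw [Measure.smul_apply, smul_eq_mul,
    Measure.map_apply (measurable_of_countable _) (MeasurableSet.singleton _)]
  by_cases h : η ∈ condensateAt R n N y
  · obtain ⟨hB, hpre⟩ := insertCondensate_preimage h
    rw [hpre, restrict_singleton_of_mem _ h, restrict_singleton_of_mem _ hB,
      weightMeasure_singleton, fluidProduct_singleton hc₁.le hc, ← ENNReal.ofReal_mul htpos.le,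
      Fin.prod_univ_succAbove _ y, prod_weight_of_le h.2.2]
    have hs : ∑ x, (y.removeNth η : Fin n → ℕ) x = ∑ x, η (y.succAbove x) := rfl
    have h1 := h.1
    have h2 := h.2.1
    rw [Fin.sum_univ_succAbove _ y] at h1
    rw [hs, weight_eq, if_neg (by omega), ht,
      show N - R = (η y - R) + ∑ x, η (y.succAbove x) by omega, pow_add, div_pow]
    congr 1
    have hu := (pow_pos hp1 n).ne'
    generalize (1 - c₁ / c₀) ^ n = u at hu ⊢
    field_simp
  · rw [restrict_singleton_of_notMem _ h, Measure.restrict_apply (.of_discrete)]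
    have : insertCondensate N y ⁻¹' {η} ∩ backgroundConfig R n N = ∅ := by
      ext ξ
      simp only [Set.mem_inter_iff, Set.mem_preimage, Set.mem_singleton_iff,
        Set.mem_empty_iff_false, iff_false]
      rintro ⟨rfl, hB⟩
      exact h (insertCondensate_mem y hB)
    rw [this, measure_empty, mul_zero]

theorem mem_condensateAt_iff {R n N : ℕ} {y : Fin (n + 1)} {η : Fin (n + 1) → ℕ} :
    η ∈ condensateAt R n N y ↔
      ∑ x, η x = N ∧ (Finset.univ.filter fun x => R < η x) = {y} := by
  simp only [condensateAt, Set.mem_ofPred_eq, Finset.ext_iff, Finset.mem_filter, Finset.mem_univ,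
    true_and, Finset.mem_singleton]
  refine and_congr_right fun _ => ⟨?_, fun h => ⟨(h y).2 rfl, fun x => ?_⟩⟩
  · rintro ⟨h1, h2⟩ x
    refine ⟨fun h => ?_, fun h => h ▸ h1⟩
    by_contra hx
    obtain ⟨z, rfl⟩ := Fin.exists_succAbove_eq hx
    exact absurd (h2 z) (not_le.2 h)
  · exact not_lt.1 fun h' => Fin.succAbove_ne y x ((h _).1 h')

theorem configWith_one (R n N : ℕ) : configWith R (n + 1) N 1 = ⋃ y, condensateAt R n N y := by
  ext η
  simp only [configWith, Set.mem_ofPred_eq, Set.mem_iUnion, mem_condensateAt_iff,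
    Finset.card_eq_one, exists_and_left]

theorem pairwise_disjoint_condensateAt (R n N : ℕ) :
    Pairwise (Function.onFun Disjoint (condensateAt R n N)) := by
  intro y z hyz
  refine Set.disjoint_left.2 fun η h1 h2 => hyz ?_
  rw [mem_condensateAt_iff] at h1 h2
  exact Finset.singleton_injective (h1.2.symm.trans h2.2)

/-- The unique site above `R` is strictly the largest, so maximality at the last site locates the
condensate there. -/
theorem configWith_one_inter_max (R n N : ℕ) :
    configWith R (n + 1) N 1 ∩ {η | ∀ x, η x ≤ η (Fin.last n)} =
      condensateAt R n N (Fin.last n) := by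
  ext η
  rw [configWith_one]
  simp only [Set.mem_inter_iff, Set.mem_iUnion, Set.mem_ofPred_eq]
  constructor
  · rintro ⟨⟨y, hy⟩, hmax⟩
    suffices y = Fin.last n by rwa [this] at hy
    have h2 := hy.2.1.trans_le (hmax y)
    rw [mem_condensateAt_iff] at hy
    have : Fin.last n ∈ (Finset.univ.filter fun x => R < η x) := by simpa using h2
    rw [hy.2, Finset.mem_singleton] at this
    exact this.symm
  · intro h
    refine ⟨⟨_, h⟩, fun x => ?_⟩
    by_cases hx : x = Fin.last n
    · rw [hx]
    · obtain ⟨z, rfl⟩ := Fin.exists_succAbove_eq hx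
      exact (h.2.2 z).trans h.2.1.le

theorem condensedBackground_eq (hc₁ : 0 < c₁) (hc : c₁ < c₀) (R n N : ℕ) :
    condensedBackground c₀ c₁ R n N = cond (fluidProduct c₀ c₁ n) (backgroundConfig R n N) := by
  obtain ⟨K, hK, hK', h⟩ := weightMeasure_restrict_condensateAt hc₁ hc R n N
  rw [condensedBackground, cond_canonical, configWith_one_inter_max,
    Set.inter_eq_right.2 fun η hη => hη.1]
  refine cond_map_eq_cond (measurable_of_countable _) hK hK' ?_
  rw [h, Measure.map_smul, Measure.map_map (measurable_of_countable _) (measurable_of_countable _)]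
  have : ((fun (η : Fin (n + 1) → ℕ) x => η (Fin.castSucc x)) ∘
      insertCondensate N (Fin.last n)) = id := by
    ext ξ x
    simp only [Function.comp, insertCondensate, id]
    rw [← Fin.succAbove_last_apply, Fin.insertNth_apply_succAbove]
  rw [this, Measure.map_id]

/-- The condensate is uniformly distributed over the sites and independent of the background. -/
theorem quasiStationary_one_eq (hc₁ : 0 < c₁) (hc : c₁ < c₀) (R n N : ℕ) :
    quasiStationary c₀ c₁ R (n + 1) N 1 = ((n + 1 : ℕ) : ℝ≥0∞)⁻¹ •
      ∑ y, (cond (fluidProduct c₀ c₁ n) (backgroundConfig R n N)).map (insertCondensate N y) := by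
  obtain ⟨K, hK, hK', h⟩ := weightMeasure_restrict_condensateAt hc₁ hc R n N
  have hr : (weightMeasure c₀ c₁ R (n + 1)).restrict (configWith R (n + 1) N 1) = K •
      ∑ y, ((fluidProduct c₀ c₁ n).restrict (backgroundConfig R n N)).map
        (insertCondensate N y) := by
    rw [configWith_one, Measure.restrict_iUnion (pairwise_disjoint_condensateAt R n N)
      fun _ => .of_discrete, Measure.sum_fintype, Finset.smul_sum]
    exact Finset.sum_congr rfl fun y _ => h y
  have hA : weightMeasure c₀ c₁ R (n + 1) (configWith R (n + 1) N 1) =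
      K * ((n + 1 : ℕ) * fluidProduct c₀ c₁ n (backgroundConfig R n N)) := by
    have := congrArg (fun m => m Set.univ) hr
    simpa [Measure.map_apply (measurable_of_countable _) MeasurableSet.univ] using this
  have hn : ((n + 1 : ℕ) : ℝ≥0∞) ≠ 0 := by simp
  have hn' : ((n + 1 : ℕ) : ℝ≥0∞) ≠ ∞ := ENNReal.natCast_ne_top _
  rw [quasiStationary_eq, ProbabilityTheory.cond, hr, hA, smul_smul,
    ENNReal.mul_inv (Or.inl hK) (Or.inl hK'), mul_right_comm, ENNReal.inv_mul_cancel hK hK',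
    one_mul, ENNReal.mul_inv (Or.inl hn) (Or.inl hn'), ← smul_smul, Finset.smul_sum]
  congr 1
  refine Finset.sum_congr rfl fun y _ => ?_
  rw [ProbabilityTheory.cond, Measure.map_smul]

/-- Insertion at `y` shifts only the background sites from `y` on. -/
theorem extendByZero_insertCondensate {n N i : ℕ} {y : Fin (n + 1)} (hi : i < y) (ξ : Fin n → ℕ) :
    extendByZero (insertCondensate N y ξ) i = extendByZero ξ i := by
  have hin : i < n := by omega
  have e : (⟨i, by omega⟩ : Fin (n + 1)) = y.succAbove ⟨i, hin⟩ := by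
    rw [Fin.succAbove_of_castSucc_lt _ _ (by rw [Fin.lt_def]; exact hi)]
    rfl
  rw [extendByZero, extendByZero, dif_pos (by omega), dif_pos hin, e, insertCondensate,
    Fin.insertNth_apply_succAbove]

/-- If `f` sees only sites below `k`, a condensate at `y ≥ k` does not change it. Each of the at
most `k` other positions costs at most `2C`, so averaging over `n + 1` positions leaves an error
`2Ck/(n+1)`. -/
theorem convergesWeakly_quasiStationary_one (hc₁ : 0 < c₁) (hc : c₁ < c₀) {R N : ℕ → ℕ}
    {ν : Measure (ℕ → ℕ)}
    (hprob : ∀ᶠ n in atTop, IsProbabilityMeasure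
      (cond (fluidProduct c₀ c₁ n) (backgroundConfig (R (n + 1)) n (N (n + 1)))))
    (h : ConvergesWeakly (fun n => cond (fluidProduct c₀ c₁ n)
      (backgroundConfig (R (n + 1)) n (N (n + 1)))) ν) :
    ConvergesWeakly (fun L => quasiStationary c₀ c₁ (R L) L (N L) 1) ν := by
  rintro S f hf ⟨C, hC⟩
  rw [← tendsto_add_atTop_iff_nat 1]
  have hlim := h S f hf ⟨C, hC⟩
  have hC0 : 0 ≤ C := (abs_nonneg _).trans (hC 0)
  set k := S.sup id + 1 with hk
  have herr : Tendsto (fun n : ℕ => 2 * C * k / ((n : ℝ) + 1)) atTop (𝓝 0) :=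
    tendsto_const_nhds.div_atTop (tendsto_atTop_add_const_right _ _ tendsto_natCast_atTop_atTop)
  suffices hd : ∀ᶠ n in atTop,
      |∫ η, f (extendByZero η) ∂(quasiStationary c₀ c₁ (R (n + 1)) (n + 1) (N (n + 1)) 1) -
        ∫ η, f (extendByZero η) ∂(cond (fluidProduct c₀ c₁ n)
          (backgroundConfig (R (n + 1)) n (N (n + 1))))| ≤ 2 * C * k / ((n : ℝ) + 1) by
    have := (squeeze_zero_norm' hd herr).add hlim
    simpa using this
  filter_upwards [hprob] with n hn
  set μ := cond (fluidProduct c₀ c₁ n) (backgroundConfig (R (n + 1)) n (N (n + 1))) with hμ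
  have hb : ∀ (g : (Fin n → ℕ) → ℕ → ℕ), |∫ ξ, f (g ξ) ∂μ| ≤ C := fun g => by
    have := norm_integral_le_of_norm_le_const (μ := μ) (f := fun ξ => f (g ξ)) (C := C)
      (ae_of_all _ fun ξ => hC _)
    simpa using this
  have hint : ∀ y ∈ (Finset.univ : Finset (Fin (n + 1))),
      Integrable (fun η : Fin (n + 1) → ℕ => f (extendByZero η))
        (μ.map (insertCondensate (N (n + 1)) y)) := fun y _ =>
    Integrable.of_bound (measurable_of_countable _).aestronglyMeasurable C (ae_of_all _ fun _ => hC _)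
  rw [quasiStationary_one_eq hc₁ hc, integral_smul_measure, integral_finsetSum_measure hint]
  have hmap : ∀ y : Fin (n + 1), ∫ η, f (extendByZero η) ∂(μ.map (insertCondensate (N (n + 1)) y)) =
      ∫ ξ, f (extendByZero (insertCondensate (N (n + 1)) y ξ)) ∂μ := fun y =>
    integral_map (measurable_of_countable _).aemeasurable
      (measurable_of_countable _).aestronglyMeasurable
  simp only [hmap]
  have hn1 : (0 : ℝ) < (n : ℝ) + 1 := by positivity
  have e : (((n + 1 : ℕ) : ℝ≥0∞)⁻¹).toReal = ((n : ℝ) + 1)⁻¹ := by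
    rw [ENNReal.toReal_inv, ENNReal.toReal_natCast]; push_cast; rfl
  set I := ∫ η, f (extendByZero η) ∂μ with hI
  have e2 : (((n + 1 : ℕ) : ℝ≥0∞)⁻¹).toReal •
      (∑ y, ∫ ξ, f (extendByZero (insertCondensate (N (n + 1)) y ξ)) ∂μ) - I =
      (∑ y : Fin (n + 1), (∫ ξ, f (extendByZero (insertCondensate (N (n + 1)) y ξ)) ∂μ - I)) /
        ((n : ℝ) + 1) := by
    rw [e, Finset.sum_sub_distrib, smul_eq_mul]
    simp only [Finset.sum_const, Finset.card_univ, Fintype.card_fin, nsmul_eq_mul]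
    push_cast
    field_simp
  rw [e2, abs_div, abs_of_pos hn1]
  gcongr
  refine (Finset.abs_sum_le_sum_abs _ _).trans ?_
  have hterm : ∀ y : Fin (n + 1),
      |∫ ξ, f (extendByZero (insertCondensate (N (n + 1)) y ξ)) ∂μ - I| ≤
        if (y : ℕ) < k then 2 * C else 0 := fun y => by
    split_ifs with hy
    · have h1 := hb fun ξ => extendByZero (insertCondensate (N (n + 1)) y ξ)
      have h2 := hb fun ξ => extendByZero ξ
      rw [abs_le] at h1 h2 ⊢
      constructor <;> linarith
    · have : ∀ ξ, f (extendByZero (insertCondensate (N (n + 1)) y ξ)) = f (extendByZero ξ) :=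
        fun ξ => hf fun i hi => by
          have : i ≤ S.sup id := Finset.le_sup (f := id) hi
          exact extendByZero_insertCondensate (by omega) ξ
      simp [this, hI]
  refine (Finset.sum_le_sum fun y _ => hterm y).trans ?_
  rw [Fin.sum_univ_eq_sum_range (fun i => if i < k then 2 * C else 0) (n + 1),
    ← Finset.sum_filter, Finset.sum_const, nsmul_eq_mul, mul_comm]
  gcongr
  refine (Finset.card_le_card (t := Finset.range k) fun i hi => ?_).trans (Finset.card_range k).le
  simpa using (Finset.mem_filter.1 hi).2

end Weights

/-! ### Ratio asymptotics for the total number of particles -/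

section Asymptotics

theorem tendsto_natSub_div {T : ℕ → ℕ} {τ : ℝ} (s : ℕ)
    (hT : Tendsto (fun n : ℕ => (T n : ℝ) / n) atTop (𝓝 τ)) :
    Tendsto (fun n : ℕ => ((T n - s : ℕ) : ℝ) / n) atTop (𝓝 τ) := by
  have hs : Tendsto (fun n : ℕ => (s : ℝ) / n) atTop (𝓝 0) :=
    tendsto_const_div_atTop_nhds_zero_nat _
  refine tendsto_of_tendsto_of_tendsto_of_le_of_le (by simpa using hT.sub hs) hT
    (fun n => ?_) (fun n => ?_)
  · simp only
    rw [← sub_div]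
    gcongr
    rw [sub_le_iff_le_add]
    have : T n ≤ T n - s + s := by omega
    exact_mod_cast this
  · simp only
    gcongr
    exact Nat.sub_le _ _

theorem tendsto_div_add_sub_one {T : ℕ → ℕ} {τ : ℝ} (hτ : 0 ≤ τ)
    (hT : Tendsto (fun n : ℕ => (T n : ℝ) / n) atTop (𝓝 τ)) :
    Tendsto (fun n : ℕ => (T n : ℝ) / (n + T n - 1)) atTop (𝓝 (τ / (1 + τ))) := by
  have h1 : Tendsto (fun n : ℕ => 1 + (T n : ℝ) / n - 1 / n) atTop (𝓝 (1 + τ - 0)) :=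
    (hT.const_add 1).sub (tendsto_const_div_atTop_nhds_zero_nat _)
  rw [sub_zero] at h1
  refine (hT.div h1 (by positivity)).congr' ?_
  filter_upwards [eventually_gt_atTop 0] with n hn
  have : (n : ℝ) ≠ 0 := by positivity
  rw [Pi.div_apply]
  field_simp

theorem tendsto_atTop_of_div {T : ℕ → ℕ} {τ : ℝ} (hτ : 0 < τ)
    (hT : Tendsto (fun n : ℕ => (T n : ℝ) / n) atTop (𝓝 τ)) : Tendsto T atTop atTop := by
  rw [← tendsto_natCast_atTop_iff (R := ℝ)]
  refine (hT.pos_mul_atTop hτ tendsto_natCast_atTop_atTop).congr' ?_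
  filter_upwards [eventually_gt_atTop 0] with n hn
  have : (n : ℝ) ≠ 0 := by positivity
  field_simp

/-- As `R` grows linearly, `n` is eventually at most `(2/a)(R n + 1)`, and `k r^k` tends to zero. -/
theorem tendsto_natCast_mul_pow {R : ℕ → ℕ} {a r : ℝ} (ha : 0 < a) (hr0 : 0 ≤ r) (hr : r < 1)
    (hR : Tendsto (fun n : ℕ => (R n : ℝ) / n) atTop (𝓝 a)) :
    Tendsto (fun n : ℕ => (n : ℝ) * r ^ (R n + 1)) atTop (𝓝 0) := by
  have h1 : Tendsto (fun n => ((R n + 1 : ℕ) : ℝ) * r ^ (R n + 1)) atTop (𝓝 0) :=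
    (tendsto_self_mul_const_pow_of_lt_one hr0 hr).comp
      ((tendsto_add_atTop_nat 1).comp (tendsto_atTop_of_div ha hR))
  have h2 := h1.const_mul (2 / a)
  rw [mul_zero] at h2
  refine squeeze_zero' (Eventually.of_forall fun n => by positivity) ?_ h2
  filter_upwards [hR.eventually (lt_mem_nhds (half_lt_self ha)), eventually_gt_atTop 0] with n hn hn0
  have hn0 : (0 : ℝ) < n := by exact_mod_cast hn0
  rw [lt_div_iff₀ hn0] at hn
  rw [← mul_assoc]
  gcongr
  rw [div_mul_eq_mul_div, le_div_iff₀ ha]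
  push_cast
  linarith

theorem multichoose_succ_right_mul (n m : ℕ) :
    (m + 1) * n.multichoose (m + 1) = (n + m) * n.multichoose m := by
  rcases n with _ | n
  · rcases m with _ | m <;> simp
  · rw [Nat.multichoose_eq, Nat.multichoose_eq, show n + 1 + (m + 1) - 1 = n + m + 1 by omega,
      show n + 1 + m - 1 = n + m by omega, mul_comm, ← Nat.add_one_mul_choose_eq]
    ring

theorem multichoose_pos {n : ℕ} (hn : 0 < n) (m : ℕ) : 0 < n.multichoose m := by
  rw [Nat.multichoose_eq]
  exact Nat.choose_pos (by omega)

variable {c₀ φ : ℝ}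

theorem fluidProduct_real_sum_eq_pos (h0 : 0 < φ) (hφ : φ < c₀) {n : ℕ} (hn : 0 < n) (m : ℕ) :
    0 < (fluidProduct c₀ φ n).real {η | ∑ x, η x = m} := by
  have hp0 : 0 < φ / c₀ := div_pos h0 (h0.trans hφ)
  have hp1 : 0 < 1 - φ / c₀ := sub_pos.2 (ratio_lt_one h0.le hφ)
  have := multichoose_pos hn m
  rw [fluidProduct_real_sum_eq h0.le hφ]
  positivity

/-- Ratio of the probabilities of consecutive values of the number of particles. -/
theorem fluidProduct_real_sum_add_succ (h0 : 0 < φ) (hφ : φ < c₀) {n : ℕ} (hn : 1 < n) (m s : ℕ) :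
    φ / c₀ * (fluidProduct c₀ φ n).real {η | ∑ x, η x + (s + 1) ∈ ({m} : Set ℕ)} =
      (fluidProduct c₀ φ n).real {η | ∑ x, η x + s ∈ ({m} : Set ℕ)} *
        (((m - s : ℕ) : ℝ) / (n + ((m - s : ℕ) : ℝ) - 1)) := by
  rcases lt_or_ge s m with h | h
  · obtain ⟨k, rfl⟩ : ∃ k, m = k + (s + 1) := ⟨m - (s + 1), by omega⟩
    have e1 : {η : Fin n → ℕ | ∑ x, η x + (s + 1) ∈ ({k + (s + 1)} : Set ℕ)} =
        {η | ∑ x, η x = k} := by ext η; simp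
    have e2 : {η : Fin n → ℕ | ∑ x, η x + s ∈ ({k + (s + 1)} : Set ℕ)} =
        {η | ∑ x, η x = k + 1} := by
      ext η; simp only [Set.mem_singleton_iff, Set.mem_ofPred_eq]; omega
    rw [e1, e2, fluidProduct_real_sum_eq h0.le hφ, fluidProduct_real_sum_eq h0.le hφ,
      show k + (s + 1) - s = k + 1 by omega]
    have hm : ((k : ℝ) + 1) * (n.multichoose (k + 1) : ℝ) = (n + k) * n.multichoose k := by
      exact_mod_cast multichoose_succ_right_mul n k
    have hpos : (0 : ℝ) < n + k := by positivity
    push_cast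
    rw [show (n : ℝ) + (k + 1) - 1 = n + k by ring, mul_div_assoc', eq_div_iff hpos.ne', pow_succ]
    linear_combination (-(φ / c₀) * ((1 - φ / c₀) ^ n * (φ / c₀) ^ k)) * hm
  · have e1 : {η : Fin n → ℕ | ∑ x, η x + (s + 1) ∈ ({m} : Set ℕ)} = ∅ := by
      refine Set.eq_empty_of_forall_notMem fun η hη => ?_
      have : ∑ x, η x + (s + 1) = m := hη
      omega
    rw [e1, Nat.sub_eq_zero_of_le h]
    simp

/-- A product of `s` consecutive ratios, each tending to `τ/(1+τ)`. The factor `(φ/c₀)^s` removes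
the dependence on the fugacity, so any positive reference `φ < c₀` will do. -/
theorem tendsto_real_sum_add_eq (h0 : 0 < φ) (hφ : φ < c₀) {T : ℕ → ℕ} {τ : ℝ} (hτ : 0 ≤ τ)
    (hT : Tendsto (fun n : ℕ => (T n : ℝ) / n) atTop (𝓝 τ)) (s : ℕ) :
    Tendsto (fun n => (φ / c₀) ^ s *
      (fluidProduct c₀ φ n).real {η | ∑ x, η x + s ∈ ({T n} : Set ℕ)} /
        (fluidProduct c₀ φ n).real {η | ∑ x, η x ∈ ({T n} : Set ℕ)}) atTop
      (𝓝 ((τ / (1 + τ)) ^ s)) := by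
  induction s with
  | zero =>
    refine tendsto_const_nhds.congr' ?_
    filter_upwards [eventually_gt_atTop 0] with n hn
    have := fluidProduct_real_sum_eq_pos h0 hφ hn (T n)
    simp only [pow_zero, one_mul, add_zero]
    exact (div_self this.ne').symm
  | succ s ih =>
    simp only [pow_succ]
    refine (ih.mul (tendsto_div_add_sub_one hτ (tendsto_natSub_div s hT))).congr' ?_
    filter_upwards [eventually_gt_atTop 1] with n hn
    rw [mul_assoc ((φ / c₀) ^ s) (φ / c₀), fluidProduct_real_sum_add_succ h0 hφ hn (T n) s]
    ring

/-- A bound valid for every `s` is needed because the truncation uses `s = R n + 1`, which grows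
with `n`. It holds since `x/(n+x-1)` increases in `x` for `n > 1`. -/
theorem fluidProduct_real_sum_add_le (h0 : 0 < φ) (hφ : φ < c₀) {n : ℕ} (hn : 1 < n) (m s : ℕ) :
    (φ / c₀) ^ s * (fluidProduct c₀ φ n).real {η | ∑ x, η x + s ∈ ({m} : Set ℕ)} ≤
      ((m : ℝ) / (n + m - 1)) ^ s *
        (fluidProduct c₀ φ n).real {η | ∑ x, η x ∈ ({m} : Set ℕ)} := by
  have hn' : (1 : ℝ) < n := by exact_mod_cast hn
  have hd : ∀ k : ℕ, (0 : ℝ) < n + k - 1 := fun k => by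
    have : (0 : ℝ) ≤ k := by positivity
    linarith
  induction s with
  | zero => simp
  | succ s ih =>
    have hle : ((m - s : ℕ) : ℝ) / (n + ((m - s : ℕ) : ℝ) - 1) ≤ (m : ℝ) / (n + m - 1) := by
      have h : ((m - s : ℕ) : ℝ) ≤ m := by exact_mod_cast Nat.sub_le _ _
      rw [div_le_div_iff₀ (hd _) (hd _)]
      nlinarith
    rw [pow_succ, mul_assoc ((φ / c₀) ^ s) (φ / c₀), fluidProduct_real_sum_add_succ h0 hφ hn m s,
      ← mul_assoc, pow_succ ((m : ℝ) / (n + m - 1)), mul_right_comm (((m : ℝ) / (n + m - 1)) ^ s)]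
    exact mul_le_mul ih hle (div_nonneg (Nat.cast_nonneg _) (hd _).le)
      (mul_nonneg (pow_nonneg (div_nonneg (Nat.cast_nonneg _) (hd m).le) _) measureReal_nonneg)

theorem tendsto_real_sum_eq_truncation (h0 : 0 < φ) (hφ : φ < c₀) {R T : ℕ → ℕ} {a τ : ℝ}
    (ha : 0 < a) (hτ : 0 ≤ τ) (hR : Tendsto (fun n : ℕ => (R n : ℝ) / n) atTop (𝓝 a))
    (hT : Tendsto (fun n : ℕ => (T n : ℝ) / n) atTop (𝓝 τ)) :
    Tendsto (fun n => n * ((φ / c₀) ^ (R n + 1) *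
      (fluidProduct c₀ φ n).real {η | ∑ x, η x + (R n + 1) ∈ ({T n} : Set ℕ)}) /
        (fluidProduct c₀ φ n).real {η | ∑ x, η x ∈ ({T n} : Set ℕ)}) atTop (𝓝 0) := by
  have hlt : τ / (1 + τ) < 1 := by rw [div_lt_one (by positivity)]; linarith
  obtain ⟨r, hr1, hr2⟩ := exists_between hlt
  have hr0 : 0 ≤ r := le_trans (by positivity) hr1.le
  refine squeeze_zero' (Eventually.of_forall fun n => ?_) ?_
    (tendsto_natCast_mul_pow ha hr0 hr2 hR)
  · have := ratio_nonneg h0.le hφ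
    positivity
  · filter_upwards [eventually_gt_atTop 1,
      (tendsto_div_add_sub_one hτ hT).eventually (gt_mem_nhds hr1)] with n hn hlt
    have hpos : 0 < (fluidProduct c₀ φ n).real {η | ∑ x, η x ∈ ({T n} : Set ℕ)} :=
      fluidProduct_real_sum_eq_pos h0 hφ (by omega) (T n)
    have hn' : (1 : ℝ) < n := by exact_mod_cast hn
    have hT0 : (0 : ℝ) ≤ T n := by positivity
    rw [div_le_iff₀ hpos, mul_assoc]
    refine mul_le_mul_of_nonneg_left ?_ (Nat.cast_nonneg n)
    refine (fluidProduct_real_sum_add_le h0 hφ hn (T n) (R n + 1)).trans ?_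
    have := div_nonneg hT0 (show (0 : ℝ) ≤ n + T n - 1 by linarith)
    gcongr

/-- At or above the typical density, the number of particles conditioned not to exceed a bound
spreads over many values. -/
theorem tendsto_real_sum_eq_div_lt (h0 : 0 < φ) (hφ : φ < c₀) {T : ℕ → ℕ} {τ : ℝ}
    (hτ : fluidDensity c₀ φ ≤ τ) (hT : Tendsto (fun n : ℕ => (T n : ℝ) / n) atTop (𝓝 τ)) :
    Tendsto (fun n => (fluidProduct c₀ φ n).real {η | ∑ x, η x < T n - 1} /
      (fluidProduct c₀ φ n).real {η | ∑ x, η x < T n}) atTop (𝓝 1) := by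
  have := isProbabilityMeasure_fluidProduct h0.le hφ
  have hc : 0 < c₀ := h0.trans hφ
  have hp0 : 0 < φ / c₀ := div_pos h0 hc
  have hd : 0 < fluidDensity c₀ φ := div_pos h0 (sub_pos.2 hφ)
  have hτ0 : 0 < τ := hd.trans_le hτ
  -- This is where the density hypothesis enters: going down one particle from the edge multiplies
  -- the point probability by at least one in the limit.
  have hr : 1 ≤ τ / (1 + τ) / (φ / c₀) := by
    rw [one_le_div hp0, div_le_div_iff₀ hc (by positivity)]
    rw [fluidDensity, div_le_iff₀ (sub_pos.2 hφ)] at hτ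
    linarith
  have hone : ∀ s, Tendsto (fun n =>
      (fluidProduct c₀ φ n).real {η | ∑ x, η x + s ∈ ({T n - 1} : Set ℕ)} /
        (fluidProduct c₀ φ n).real {η | ∑ x, η x ∈ ({T n - 1} : Set ℕ)}) atTop
      (𝓝 ((τ / (1 + τ) / (φ / c₀)) ^ s)) := fun s => by
    have := (tendsto_real_sum_add_eq h0 hφ hτ0.le (tendsto_natSub_div 1 hT) s).div_const
      ((φ / c₀) ^ s)
    rw [← div_pow] at this
    refine this.congr fun n => ?_
    have : (φ / c₀) ^ s ≠ 0 := by positivity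
    field_simp
  have htop : Tendsto (fun n => (fluidProduct c₀ φ n).real {η | ∑ x, η x < T n} /
      (fluidProduct c₀ φ n).real {η | ∑ x, η x ∈ ({T n - 1} : Set ℕ)}) atTop atTop := by
    rw [tendsto_atTop]
    intro b
    -- The `K` values just below the edge have probabilities whose sum, relative to that of the edge
    -- value, has a limit at least `K`, with `K` arbitrary.
    obtain ⟨K, hK⟩ := exists_nat_gt b
    have hsum := tendsto_finsetSum (Finset.range K) fun s _ => hone s
    have hKle : (K : ℝ) ≤ ∑ s ∈ Finset.range K, (τ / (1 + τ) / (φ / c₀)) ^ s := by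
      have := Finset.card_nsmul_le_sum (Finset.range K)
        (fun s => (τ / (1 + τ) / (φ / c₀)) ^ s) 1 fun s _ => one_le_pow₀ hr
      simpa using this
    filter_upwards [hsum.eventually (lt_mem_nhds (hK.trans_le hKle)),
      (tendsto_atTop_of_div hτ0 hT).eventually_gt_atTop 0] with n hn hTn
    refine hn.le.trans ?_
    rw [← Finset.sum_div]
    refine div_le_div_of_nonneg_right ?_ measureReal_nonneg
    rw [← measureReal_biUnion_finset]
    · refine measureReal_mono ?_
      intro η hη
      simp only [Set.mem_iUnion, Set.mem_singleton_iff, Set.mem_ofPred_eq] at hη ⊢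
      obtain ⟨s, -, hs⟩ := hη
      omega
    · intro s _ t _ hst
      refine Set.disjoint_left.2 fun η h1 h2 => hst ?_
      simp only [Set.mem_singleton_iff, Set.mem_ofPred_eq] at h1 h2
      omega
    · exact fun _ _ => .of_discrete
  have h1 := (htop.inv_tendsto_atTop).const_sub 1
  rw [sub_zero] at h1
  refine h1.congr' ?_
  filter_upwards [htop.eventually_gt_atTop 0,
    (tendsto_atTop_of_div hτ0 hT).eventually_gt_atTop 0] with n hn hTn
  have hU : (fluidProduct c₀ φ n).real {η | ∑ x, η x < T n} ≠ 0 := fun h => by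
    rw [h, zero_div] at hn; exact hn.false
  have hadd : (fluidProduct c₀ φ n).real {η | ∑ x, η x < T n} =
      (fluidProduct c₀ φ n).real {η | ∑ x, η x < T n - 1} +
        (fluidProduct c₀ φ n).real {η | ∑ x, η x ∈ ({T n - 1} : Set ℕ)} := by
    rw [← measureReal_union _ (.of_discrete)]
    · congr 1
      ext η
      simp only [Set.mem_singleton_iff, Set.mem_ofPred_eq, Set.mem_union]
      omega
    · refine Set.disjoint_left.2 fun η h1 h2 => ?_
      simp only [Set.mem_singleton_iff, Set.mem_ofPred_eq] at h1 h2
      omega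
  rw [Pi.inv_apply, inv_div, eq_div_iff hU, sub_mul, div_mul_cancel₀ _ hU]
  linarith

theorem tendsto_real_sum_add_lt (h0 : 0 < φ) (hφ : φ < c₀) {T : ℕ → ℕ} {τ : ℝ}
    (hτ : fluidDensity c₀ φ ≤ τ) (hT : Tendsto (fun n : ℕ => (T n : ℝ) / n) atTop (𝓝 τ)) (s : ℕ) :
    Tendsto (fun n => (fluidProduct c₀ φ n).real {η | ∑ x, η x + s < T n} /
      (fluidProduct c₀ φ n).real {η | ∑ x, η x < T n}) atTop (𝓝 1) := by
  have := isProbabilityMeasure_fluidProduct h0.le hφ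
  have hd : 0 < fluidDensity c₀ φ := div_pos h0 (sub_pos.2 hφ)
  have hpos : ∀ s, ∀ᶠ n in atTop, 0 < (fluidProduct c₀ φ n).real {η | ∑ x, η x + s < T n} := by
    intro s
    filter_upwards [eventually_gt_atTop 0,
      (tendsto_atTop_of_div (hd.trans_le hτ) hT).eventually_gt_atTop s] with n hn hTn
    refine (fluidProduct_real_sum_eq_pos h0 hφ hn 0).trans_le (measureReal_mono fun η hη => ?_)
    simp only [Set.mem_ofPred_eq] at hη ⊢
    omega
  induction s with
  | zero =>
    refine tendsto_const_nhds.congr' ?_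
    filter_upwards [hpos 0] with n hn
    simp only [add_zero] at hn ⊢
    exact (div_self hn.ne').symm
  | succ s ih =>
    have h := (tendsto_real_sum_eq_div_lt h0 hφ hτ (tendsto_natSub_div s hT)).mul ih
    rw [one_mul] at h
    refine h.congr' ?_
    filter_upwards [hpos s] with n hn
    have e1 : {η : Fin n → ℕ | ∑ x, η x < T n - s} = {η | ∑ x, η x + s < T n} := by
      ext η; simp only [Set.mem_ofPred_eq]; omega
    have e2 : {η : Fin n → ℕ | ∑ x, η x < T n - s - 1} = {η | ∑ x, η x + (s + 1) < T n} := by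
      ext η; simp only [Set.mem_ofPred_eq]; omega
    rw [e1, e2, div_mul_div_cancel₀ hn.ne']

end Asymptotics

/-! ### Moments of the geometric law and concentration of the total -/

section Chebyshev

variable {c₀ φ : ℝ}

theorem fluidMarginal_eq_geometricMeasure (h0 : 0 ≤ φ) (hφ : φ < c₀) :
    ∃ p : unitInterval, p ≠ 0 ∧ (p : ℝ) = 1 - φ / c₀ ∧ fluidMarginal c₀ φ = geometricMeasure p := by
  have hp0 := ratio_nonneg h0 hφ
  have hp1 := ratio_lt_one h0 hφ
  have hne : (⟨1 - φ / c₀, by linarith, by linarith⟩ : unitInterval) ≠ 0 := fun h => by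
    have : 1 - φ / c₀ = 0 := congrArg Subtype.val h
    linarith
  refine ⟨_, hne, rfl, Measure.ext_of_singleton fun k => ?_⟩
  rw [fluidMarginal_singleton h0 hφ, geometricMeasure_singleton hne]
  congr 1
  simp only [sub_sub_cancel]
  ring

theorem memLp_fluidMarginal (h0 : 0 ≤ φ) (hφ : φ < c₀) :
    MemLp (fun k : ℕ => (k : ℝ)) 2 (fluidMarginal c₀ φ) := by
  obtain ⟨p, hp, hpe, he⟩ := fluidMarginal_eq_geometricMeasure h0 hφ
  rw [memLp_two_iff_integrable_sq (measurable_of_countable _).aestronglyMeasurable, he,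
    integrable_geometricMeasure_iff hp, hpe]
  have hr : ‖φ / c₀‖ < 1 := by
    rw [Real.norm_of_nonneg (ratio_nonneg h0 hφ)]; exact ratio_lt_one h0 hφ
  refine ((summable_pow_mul_geometric_of_norm_lt_one 2 hr).mul_right (1 - φ / c₀)).congr fun k => ?_
  rw [Real.norm_of_nonneg (by positivity), sub_sub_cancel]
  ring

theorem integral_fluidMarginal (h0 : 0 ≤ φ) (hφ : φ < c₀) :
    ∫ k : ℕ, (k : ℝ) ∂(fluidMarginal c₀ φ) = fluidDensity c₀ φ := by
  obtain ⟨p, hp, hpe, he⟩ := fluidMarginal_eq_geometricMeasure h0 hφ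
  have hp1 := ratio_lt_one h0 hφ
  have hr : ‖φ / c₀‖ < 1 := by
    rw [Real.norm_of_nonneg (ratio_nonneg h0 hφ)]; exact hp1
  have hc : 0 < c₀ := h0.trans_lt hφ
  have hd : c₀ - φ ≠ 0 := (sub_pos.2 hφ).ne'
  have hq : 1 - φ / c₀ ≠ 0 := (sub_pos.2 hp1).ne'
  rw [he, integral_geometricMeasure hp, hpe]
  have : ∀ k : ℕ, ((1 - (1 - φ / c₀)) ^ k * (1 - φ / c₀)) • (k : ℝ) =
      (1 - φ / c₀) * (k * (φ / c₀) ^ k) := fun k => by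
    rw [sub_sub_cancel, smul_eq_mul]; ring
  simp only [this]
  rw [tsum_mul_left, tsum_coe_mul_geometric_of_norm_lt_one hr, fluidDensity]
  field_simp

/-- Chebyshev's inequality for the number of particles. -/
theorem fluidProduct_real_sum_ge_le (h0 : 0 ≤ φ) (hφ : φ < c₀) (n : ℕ) {x : ℝ} (hx : 0 < x) :
    (fluidProduct c₀ φ n).real {η | fluidDensity c₀ φ * n + x ≤ ((∑ y, η y : ℕ) : ℝ)} ≤
      n * Var[fun k : ℕ => (k : ℝ); fluidMarginal c₀ φ] / x ^ 2 := by
  have := isProbabilityMeasure_fluidMarginal h0 hφ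
  have := isProbabilityMeasure_fluidProduct h0 hφ n
  have hm := memLp_fluidMarginal h0 hφ
  have hmi : ∀ i : Fin n, MemLp (fun η : Fin n → ℕ => (η i : ℝ)) 2 (fluidProduct c₀ φ n) :=
    fun i => hm.comp_measurePreserving
      (measurePreserving_eval (fun _ : Fin n => fluidMarginal c₀ φ) i)
  set X : (Fin n → ℕ) → ℝ := ∑ i, fun η => (η i : ℝ) with hX
  have hXe : ∀ η, X η = ((∑ y, η y : ℕ) : ℝ) := fun η => by simp [hX]
  have hXm : MemLp X 2 (fluidProduct c₀ φ n) := by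
    rw [hX]; exact memLp_finsetSum' _ fun i _ => hmi i
  have hvar : Var[X; fluidProduct c₀ φ n] = n * Var[fun k : ℕ => (k : ℝ); fluidMarginal c₀ φ] := by
    rw [hX, fluidProduct, variance_sum_pi (X := fun (_ : Fin n) (k : ℕ) => (k : ℝ)) fun _ => hm]
    simp
  have hmean : ∫ η, X η ∂(fluidProduct c₀ φ n) = fluidDensity c₀ φ * n := by
    have : ∀ i : Fin n, ∫ η, (η i : ℝ) ∂(fluidProduct c₀ φ n) = fluidDensity c₀ φ := fun i => by
      rw [← integral_fluidMarginal h0 hφ,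
        ← (measurePreserving_eval (fun _ : Fin n => fluidMarginal c₀ φ) i).map_eq,
        integral_map (measurable_pi_apply i).aemeasurable
          (measurable_of_countable _).aestronglyMeasurable]
      rfl
    simp only [hX, Finset.sum_apply]
    rw [integral_finsetSum _ fun i _ => (hmi i).integrable (by norm_num)]
    simp [this, mul_comm]
  have h := meas_ge_le_variance_div_sq hXm hx
  rw [hvar, hmean] at h
  rw [measureReal_def]
  refine ENNReal.toReal_le_of_le_ofReal ?_ ((measure_mono fun η hη => ?_).trans h)
  · exact div_nonneg (mul_nonneg (Nat.cast_nonneg _) (variance_nonneg _ _)) (sq_nonneg _)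
  · have hη : fluidDensity c₀ φ * n + x ≤ ((∑ y, η y : ℕ) : ℝ) := hη
    change x ≤ |X η - fluidDensity c₀ φ * n|
    rw [hXe]
    exact le_trans (by linarith) (le_abs_self _)

end Chebyshev

/-! ### Subexponential lower bound at the typical density -/

section LocalBound

/-- The Stirling sequence decreases from its first term `e/√2`. -/
theorem log_factorial_le {n : ℕ} (hn : 0 < n) :
    Real.log n.factorial ≤ 1 + Real.log n / 2 + n * Real.log n - n := by
  obtain ⟨m, rfl⟩ : ∃ m, n = m + 1 := ⟨n - 1, by omega⟩
  have h := Stirling.log_stirlingSeq'_antitone (Nat.zero_le m)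
  have hn : ((m + 1 : ℕ) : ℝ) ≠ 0 := by positivity
  simp only [Function.comp, Nat.succ_eq_add_one, zero_add] at h
  rw [Stirling.stirlingSeq_one, Stirling.log_stirlingSeq_formula,
    Real.log_div (Real.exp_pos 1).ne' (by positivity), Real.log_exp, Real.log_sqrt (by norm_num),
    Real.log_mul two_ne_zero hn, Real.log_div hn (Real.exp_pos 1).ne', Real.log_exp] at h
  linarith

theorem le_log_factorial (n : ℕ) : n * Real.log n - n ≤ Real.log n.factorial := by
  rcases Nat.eq_zero_or_pos n with rfl | hn
  · simp
  have h := Stirling.le_log_factorial_stirling hn.ne'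
  have h1 : 0 ≤ Real.log n := Real.log_natCast_nonneg n
  have h2 : 0 ≤ Real.log (2 * Real.pi) := Real.log_nonneg (by linarith [Real.pi_gt_three])
  linarith

theorem multichoose_mul_factorial {n : ℕ} (hn : 0 < n) (m : ℕ) :
    n.multichoose m * (n + m) * (n.factorial * m.factorial) = n * (n + m).factorial := by
  obtain ⟨l, rfl⟩ : ∃ l, n = l + 1 := ⟨n - 1, by omega⟩
  have h := Nat.add_choose_mul_factorial_mul_factorial l m
  rw [Nat.multichoose_eq, show l + 1 + m - 1 = l + m by omega,
    show l + 1 + m = l + m + 1 by omega, Nat.factorial_succ (l + m), ← h, Nat.factorial_succ l]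
  ring

theorem le_log_multichoose {n m : ℕ} (hn : 0 < n) (hm : 0 < m) :
    (n + m) * Real.log (n + m) - n * Real.log n - m * Real.log m + Real.log n / 2
      - Real.log (n + m) - 2 - Real.log m / 2 ≤ Real.log (n.multichoose m) := by
  have h : Real.log ((n.multichoose m * (n + m) * (n.factorial * m.factorial) : ℕ) : ℝ) =
      Real.log ((n * (n + m).factorial : ℕ) : ℝ) := by rw [multichoose_mul_factorial hn]
  have h1 : (n.multichoose m : ℝ) ≠ 0 := by
    have := multichoose_pos hn m
    positivity
  have h2 : (n : ℝ) ≠ 0 := by positivity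
  have h3 : (n : ℝ) + m ≠ 0 := by positivity
  push_cast at h
  rw [Real.log_mul (by positivity) (by positivity), Real.log_mul h1 h3,
    Real.log_mul (by positivity) (by positivity), Real.log_mul h2 (by positivity)] at h
  have b1 := log_factorial_le hn
  have b2 := log_factorial_le hm
  have b3 := le_log_factorial (n + m)
  push_cast at b3
  linarith

/-- The upper bound is trivial, a probability being at most one. Below, Stirling gives an
exponential rate that vanishes when the fugacity matches the density, up to errors of order `log L /
L`. -/
theorem tendsto_log_real_sum_eq_div {c₀ ρ : ℝ} (hc₀ : 0 < c₀) (hρ : 0 < ρ) {N : ℕ → ℕ}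
    (hN : Tendsto (fun L : ℕ => (N L : ℝ) / L) atTop (𝓝 ρ)) :
    Tendsto (fun L : ℕ => Real.log ((fluidProduct c₀ (fluidFugacity c₀ ρ) L).real
      {η | ∑ x, η x ∈ ({N L} : Set ℕ)}) / L) atTop (𝓝 0) := by
  have h1ρ : 0 < 1 + ρ := by positivity
  have hp : fluidFugacity c₀ ρ / c₀ = ρ / (1 + ρ) := by
    rw [fluidFugacity, mul_div_cancel_left₀ _ hc₀.ne']
  have h0 : 0 < fluidFugacity c₀ ρ := by unfold fluidFugacity; positivity
  have hlt : fluidFugacity c₀ ρ < c₀ := by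
    rw [← div_lt_one hc₀, hp, div_lt_one h1ρ]; linarith
  have hq : 1 - ρ / (1 + ρ) = (1 + ρ)⁻¹ := by field_simp; ring
  have hlogL : Tendsto (fun L : ℕ => Real.log L / L) atTop (𝓝 0) :=
    (Real.isLittleO_log_id_atTop.tendsto_div_nhds_zero).comp tendsto_natCast_atTop_atTop
  have hl1 : Tendsto (fun L : ℕ => Real.log (1 + (N L : ℝ) / L)) atTop (𝓝 (Real.log (1 + ρ))) :=
    (hN.const_add 1).log h1ρ.ne'
  have hl2 : Tendsto (fun L : ℕ => Real.log ((N L : ℝ) / L)) atTop (𝓝 (Real.log ρ)) :=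
    hN.log hρ.ne'
  have hinv : Tendsto (fun L : ℕ => ((L : ℝ))⁻¹) atTop (𝓝 0) := tendsto_inv_atTop_nhds_zero_nat
  -- The rate: the entropy of the multiset count, plus the logarithm of the mass of one
  -- configuration. The remaining Stirling corrections are in `herr`.
  have hmain := (((hN.const_add 1).mul hl1).sub (hN.mul hl2)).add
    ((hN.mul_const (Real.log ρ - Real.log (1 + ρ))).sub_const (Real.log (1 + ρ)))
  have herr := hlogL.add (((hl1.add_const 2).add (hl2.div_const 2)).mul hinv)
  have hlow := hmain.sub herr
  have hz : (1 + ρ) * Real.log (1 + ρ) - ρ * Real.log ρ +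
      (ρ * (Real.log ρ - Real.log (1 + ρ)) - Real.log (1 + ρ)) -
      (0 + (Real.log (1 + ρ) + 2 + Real.log ρ / 2) * 0) = 0 := by ring
  rw [hz] at hlow
  refine tendsto_of_tendsto_of_tendsto_of_le_of_le' hlow tendsto_const_nhds
    ?_ (Eventually.of_forall fun L => ?_)
  · filter_upwards [eventually_gt_atTop 0, (tendsto_atTop_of_div hρ hN).eventually_gt_atTop 0]
      with L hL hNL
    have hL' : (0 : ℝ) < L := by exact_mod_cast hL
    have hN' : (0 : ℝ) < N L := by exact_mod_cast hNL
    have hmc : (L.multichoose (N L) : ℝ) ≠ 0 := by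
      have := multichoose_pos hL (N L)
      positivity
    have hb := le_log_multichoose hL hNL
    have e1 : Real.log ((N L : ℝ) / L) = Real.log (N L) - Real.log L :=
      Real.log_div hN'.ne' hL'.ne'
    have e2 : Real.log (1 + (N L : ℝ) / L) = Real.log (L + N L) - Real.log L := by
      rw [← Real.log_div (by positivity) hL'.ne']
      congr 1
      field_simp
    have e3 : Real.log ((fluidProduct c₀ (fluidFugacity c₀ ρ) L).real
        {η | ∑ x, η x ∈ ({N L} : Set ℕ)}) = Real.log (L.multichoose (N L)) -
          L * Real.log (1 + ρ) + N L * (Real.log ρ - Real.log (1 + ρ)) := by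
      have := fluidProduct_real_sum_eq h0.le hlt L (N L)
      simp only [Set.mem_singleton_iff]
      rw [this, hp, hq, Real.log_mul hmc (by positivity), Real.log_mul (by positivity)
        (by positivity), Real.log_pow, Real.log_pow, Real.log_inv, Real.log_div hρ.ne' h1ρ.ne']
      ring
    rw [e3, le_div_iff₀ hL', e1, e2]
    refine le_trans (le_of_eq ?_) (add_le_add_left (sub_le_sub_right hb _) _)
    field_simp
    ring
  · have := isProbabilityMeasure_fluidProduct h0.le hlt L
    exact div_nonpos_of_nonpos_of_nonneg (Real.log_nonpos measureReal_nonneg measureReal_le_one)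
      (Nat.cast_nonneg _)

end LocalBound

/-! ### The fluid and condensed phases -/

section Phases

variable {c₀ c₁ a ρ : ℝ} {R N : ℕ → ℕ}

theorem fluidFugacity_div (hc₀ : 0 < c₀) (ρ : ℝ) : fluidFugacity c₀ ρ / c₀ = ρ / (1 + ρ) := by
  rw [fluidFugacity, mul_div_cancel_left₀ _ hc₀.ne']

theorem fluidFugacity_nonneg (hc₀ : 0 < c₀) (hρ : 0 ≤ ρ) : 0 ≤ fluidFugacity c₀ ρ := by
  unfold fluidFugacity; positivity

theorem fluidFugacity_lt (hc₀ : 0 < c₀) (hρ : 0 ≤ ρ) : fluidFugacity c₀ ρ < c₀ := by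
  rw [← div_lt_one hc₀, fluidFugacity_div hc₀, div_lt_one (by positivity)]
  linarith

theorem convergesWeakly_quasiStationary_zero (hc₁ : 0 < c₁) (hc : c₁ < c₀) (ha : 0 < a)
    (hρ : 0 ≤ ρ) (hR : Tendsto (fun L : ℕ => (R L : ℝ) / L) atTop (𝓝 a))
    (hN : Tendsto (fun L : ℕ => (N L : ℝ) / L) atTop (𝓝 ρ)) :
    ConvergesWeakly (fun L => quasiStationary c₀ c₁ (R L) L (N L) 0)
      (fluidInfinite c₀ (fluidFugacity c₀ ρ)) := by
  have hc₀ := hc₁.trans hc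
  -- The reference fugacity is `c₁`, not the limiting one: the latter vanishes at `ρ = 0`, where it
  -- gives no mass to `N L > 0` particles.
  have e : (fun L => quasiStationary c₀ c₁ (R L) L (N L) 0) = fun L =>
      cond (fluidProduct c₀ c₁ L) {η | ∑ x, η x ∈ ({N L} : Set ℕ) ∧ ∀ x, η x ≤ R L} :=
    funext fun L => quasiStationary_zero_eq hc₁.le hc (by positivity)
  rw [e]
  refine (convergesWeakly_cond (D := fun L => {N L}) hc₁.le hc (fluidFugacity_nonneg hc₀ hρ)
    (fluidFugacity_lt hc₀ hρ) (fun s => ?_)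
    (tendsto_real_sum_eq_truncation hc₁ hc ha hρ hR hN)).2
  rw [fluidFugacity_div hc₀]
  exact tendsto_real_sum_add_eq hc₁ hc hρ hN s

theorem tendsto_klDiv_quasiStationary_zero (hc₁ : 0 < c₁) (hc : c₁ < c₀) (ha : 0 < a)
    (hρ : 0 ≤ ρ) (hR : Tendsto (fun L : ℕ => (R L : ℝ) / L) atTop (𝓝 a))
    (hN : Tendsto (fun L : ℕ => (N L : ℝ) / L) atTop (𝓝 ρ))
    (hN0 : ρ = 0 → ∀ᶠ L in atTop, N L = 0) :
    Tendsto (fun L : ℕ => klDiv (quasiStationary c₀ c₁ (R L) L (N L) 0)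
      (fluidProduct c₀ (fluidFugacity c₀ ρ) L) / (L : ℝ≥0∞)) atTop (𝓝 0) := by
  have hc₀ := hc₁.trans hc
  have h0 := fluidFugacity_nonneg hc₀ hρ
  have hlt := fluidFugacity_lt hc₀ hρ
  have := isProbabilityMeasure_fluidProduct h0 hlt
  rcases hρ.eq_or_lt with rfl | hρ0
  -- At fugacity zero the product measure sits on the empty configuration, so conditioning on it
  -- costs nothing.
  · refine tendsto_const_nhds.congr' ?_
    filter_upwards [hN0 rfl] with L hL
    have hA : {η : Fin L → ℕ | ∑ x, η x ∈ ({N L} : Set ℕ) ∧ ∀ x, η x ≤ R L} =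
        {η | ∑ x, η x = 0} := by
      ext η
      simp only [hL, Set.mem_singleton_iff, Set.mem_ofPred_eq, and_iff_left_iff_imp]
      intro h x
      have := (Finset.sum_eq_zero_iff.1 h) x (Finset.mem_univ x)
      omega
    have hA1 : (fluidProduct c₀ (fluidFugacity c₀ 0) L).real {η | ∑ x, η x = 0} = 1 := by
      rw [fluidProduct_real_sum_eq h0 hlt, fluidFugacity_div hc₀]
      simp
    rw [quasiStationary_zero_eq h0 hlt (by rw [hL, pow_zero]; exact one_ne_zero), hA,
      klDiv_cond _ .of_discrete, hA1]
    · simp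
    · intro h
      rw [measureReal_def, h] at hA1
      simp at hA1
  · have hφ0 : 0 < fluidFugacity c₀ ρ := by unfold fluidFugacity; positivity
    have ht := tendsto_real_truncation (D := fun L => {N L}) (R := R) hφ0.le hlt
      (tendsto_real_sum_add_eq hφ0 hlt hρ hN)
      (tendsto_real_sum_eq_truncation hφ0 hlt ha hρ hR hN)
    -- The logarithm splits into that of the truncation ratio, which is `o(1)`, and that of the
    -- local probability of the total, which is `o(L)`.
    have h1 := ((ht.log one_ne_zero).mul tendsto_inv_atTop_nhds_zero_nat).add
      (tendsto_log_real_sum_eq_div hc₀ hρ0 hN)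
    simp only [Real.log_one, zero_mul, add_zero] at h1
    have h2 := ENNReal.tendsto_ofReal h1.neg
    rw [neg_zero, ENNReal.ofReal_zero] at h2
    refine h2.congr' ?_
    filter_upwards [eventually_gt_atTop 0, ht.eventually_ne one_ne_zero] with L hL hne
    have hb : (fluidProduct c₀ (fluidFugacity c₀ ρ) L).real
        {η | ∑ x, η x ∈ ({N L} : Set ℕ)} ≠ 0 := fun h => hne (by rw [h, div_zero])
    have hA : (fluidProduct c₀ (fluidFugacity c₀ ρ) L).real
        {η | ∑ x, η x ∈ ({N L} : Set ℕ) ∧ ∀ x, η x ≤ R L} ≠ 0 :=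
      fun h => hne (by rw [h, zero_div])
    have hL' : (0 : ℝ) < L := by exact_mod_cast hL
    rw [quasiStationary_zero_eq hφ0.le hlt (by positivity), klDiv_cond _ .of_discrete,
      ← ENNReal.ofReal_natCast L, ← ENNReal.ofReal_div_of_pos hL', Real.log_div hA hb]
    · congr 1
      ring
    · intro h
      exact hA (by rw [measureReal_def, h]; rfl)

/-- The background lives on `n = L - 1` sites while `R` and `N` are taken at `L`. -/
theorem tendsto_succ_div {T : ℕ → ℕ} {τ : ℝ}
    (hT : Tendsto (fun L : ℕ => (T L : ℝ) / L) atTop (𝓝 τ)) :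
    Tendsto (fun n : ℕ => (T (n + 1) : ℝ) / n) atTop (𝓝 τ) := by
  have h1 : Tendsto (fun n : ℕ => 1 + 1 / (n : ℝ)) atTop (𝓝 (1 + 0)) :=
    (tendsto_const_div_atTop_nhds_zero_nat 1).const_add 1
  have h2 := ((tendsto_add_atTop_iff_nat 1).2 hT).mul h1
  rw [add_zero, mul_one] at h2
  refine h2.congr' ?_
  filter_upwards [eventually_gt_atTop 0] with n hn
  have : (n : ℝ) ≠ 0 := by positivity
  push_cast
  field_simp

theorem convergesWeakly_quasiStationary_one_of_le (hc₁ : 0 < c₁) (hc : c₁ < c₀) (ha : 0 < a)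
    (hR : Tendsto (fun L : ℕ => (R L : ℝ) / L) atTop (𝓝 a))
    (hN : Tendsto (fun L : ℕ => (N L : ℝ) / L) atTop (𝓝 ρ)) (hρ : criticalDensity c₀ c₁ + a ≤ ρ) :
    ConvergesWeakly (fun L => quasiStationary c₀ c₁ (R L) L (N L) 1) (fluidInfinite c₀ c₁) := by
  have hc₀ := hc₁.trans hc
  have := isProbabilityMeasure_fluidProduct hc₁.le hc
  have hd : 0 < fluidDensity c₀ c₁ := div_pos hc₁ (sub_pos.2 hc)
  rw [criticalDensity] at hρ
  have hR' := tendsto_succ_div hR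
  have hdiff := (tendsto_succ_div hN).sub hR'
  have hT : Tendsto (fun n : ℕ => ((N (n + 1) - R (n + 1) : ℕ) : ℝ) / n) atTop (𝓝 (ρ - a)) := by
    refine hdiff.congr' ?_
    filter_upwards [eventually_gt_atTop 0,
      hdiff.eventually (lt_mem_nhds (show (0 : ℝ) < ρ - a by linarith))] with n hn hpos
    have hn' : (0 : ℝ) < n := by exact_mod_cast hn
    rw [← sub_div, lt_div_iff₀ hn', zero_mul, sub_pos] at hpos
    rw [Nat.cast_sub (by exact_mod_cast hpos.le), sub_div]
  have hQ : ∀ n s, {η : Fin n → ℕ | ∑ x, η x + s ∈ {m | m + R (n + 1) < N (n + 1)}} =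
      {η | ∑ x, η x + s < N (n + 1) - R (n + 1)} := fun n s => by
    ext η; simp only [Set.mem_ofPred_eq]; omega
  have hQ0 : ∀ n, {η : Fin n → ℕ | ∑ x, η x ∈ {m | m + R (n + 1) < N (n + 1)}} =
      {η | ∑ x, η x < N (n + 1) - R (n + 1)} := fun n => hQ n 0
  have h := convergesWeakly_cond (D := fun n => {m | m + R (n + 1) < N (n + 1)})
    (R := fun n => R (n + 1)) hc₁.le hc hc₁.le hc (fun s => ?_) ?_
  · exact convergesWeakly_quasiStationary_one hc₁ hc h.1 h.2
  · simp only [hQ, hQ0]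
    have := (tendsto_real_sum_add_lt hc₁ hc (show fluidDensity c₀ c₁ ≤ ρ - a by linarith)
      hT s).const_mul ((c₁ / c₀) ^ s)
    rw [mul_one] at this
    exact this.congr fun n => by rw [mul_div_assoc]
  · have hp0 := ratio_nonneg hc₁.le hc
    -- Here `D` is a down-set, so shifting the total up by `R + 1` only shrinks the event; the ratio
    -- is at most one and the geometric factor suffices.
    refine squeeze_zero (fun n => by positivity) (fun n => ?_)
      (tendsto_natCast_mul_pow ha hp0 (ratio_lt_one hc₁.le hc) hR')
    rw [← mul_assoc]
    refine div_le_of_le_mul₀ measureReal_nonneg (by positivity)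
      (mul_le_mul_of_nonneg_left (measureReal_mono fun η hη => ?_) (by positivity))
    simp only [Set.mem_ofPred_eq] at hη ⊢
    omega

/-- The event fails only if some site exceeds `R`, which is exponentially unlikely, or if the total
reaches `N - R`, an excess over the mean far beyond the scale `√n` and so excluded by Chebyshev. -/
theorem tendsto_real_backgroundConfig (hc₁ : 0 < c₁) (hc : c₁ < c₀) (ha : 0 < a)
    (hR : Tendsto (fun L : ℕ => (R L : ℝ) / L) atTop (𝓝 a))
    (ht : Tendsto (fun L : ℕ =>
      ((N L : ℝ) - R L - criticalDensity c₀ c₁ * L) / √(L : ℝ)) atTop atTop) :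
    Tendsto (fun n => (fluidProduct c₀ c₁ n).real (backgroundConfig (R (n + 1)) n (N (n + 1))))
      atTop (𝓝 1) := by
  have := isProbabilityMeasure_fluidProduct hc₁.le hc
  have hd : 0 < fluidDensity c₀ c₁ := div_pos hc₁ (sub_pos.2 hc)
  set V := Var[fun k : ℕ => (k : ℝ); fluidMarginal c₀ c₁] with hV
  have hV0 : 0 ≤ V := variance_nonneg _ _
  have ht' := (tendsto_add_atTop_iff_nat 1).2 ht
  set t : ℕ → ℝ := fun n => ((N (n + 1) : ℝ) - R (n + 1) -
    criticalDensity c₀ c₁ * ((n + 1 : ℕ) : ℝ)) / √((n + 1 : ℕ) : ℝ) with ht_def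
  have h1 := tendsto_natCast_mul_pow ha (ratio_nonneg hc₁.le hc) (ratio_lt_one hc₁.le hc)
    (tendsto_succ_div hR)
  have h2 : Tendsto (fun n => V / t n ^ 2) atTop (𝓝 0) :=
    tendsto_const_nhds.div_atTop ((tendsto_pow_atTop two_ne_zero).comp ht')
  have h3 := (h1.add h2).const_sub 1
  rw [add_zero, sub_zero] at h3
  refine tendsto_of_tendsto_of_tendsto_of_le_of_le' h3 tendsto_const_nhds ?_
    (Eventually.of_forall fun n => measureReal_le_one)
  filter_upwards [ht'.eventually_gt_atTop 0] with n hn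
  have hs : 0 < √((n + 1 : ℕ) : ℝ) := by positivity
  have hx : (N (n + 1) : ℝ) - R (n + 1) - fluidDensity c₀ c₁ * ((n + 1 : ℕ) : ℝ) =
      t n * √((n + 1 : ℕ) : ℝ) := by
    rw [ht_def, criticalDensity, div_mul_cancel₀ _ hs.ne']
  have hxpos : 0 < t n * √((n + 1 : ℕ) : ℝ) := mul_pos hn hs
  have hcheb := fluidProduct_real_sum_ge_le hc₁.le hc n hxpos
  have hsq : (t n * √((n + 1 : ℕ) : ℝ)) ^ 2 = t n ^ 2 * (n + 1) := by
    rw [mul_pow, Real.sq_sqrt (by positivity)]; push_cast; ring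
  have hcheb' : n * V / (t n * √((n + 1 : ℕ) : ℝ)) ^ 2 ≤ V / t n ^ 2 := by
    rw [hsq, div_le_div_iff₀ (by positivity) (by positivity)]
    nlinarith [mul_nonneg hV0 (sq_nonneg (t n))]
  have hmax := fluidProduct_real_exists_lt_inter hc₁.le hc n (R (n + 1)) Set.univ
  simp only [Set.mem_univ, and_true, Set.ofPred_true, probReal_univ, mul_one] at hmax
  have hcompl := probReal_compl_eq_one_sub (μ := fluidProduct c₀ c₁ n)
    (s := backgroundConfig (R (n + 1)) n (N (n + 1))) .of_discrete
  have hsub : (fluidProduct c₀ c₁ n).real (backgroundConfig (R (n + 1)) n (N (n + 1)))ᶜ ≤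
      (fluidProduct c₀ c₁ n).real {η | ∃ x, R (n + 1) < η x} +
      (fluidProduct c₀ c₁ n).real {η | fluidDensity c₀ c₁ * n + t n * √((n + 1 : ℕ) : ℝ) ≤
        ((∑ y, η y : ℕ) : ℝ)} := by
    refine le_trans (measureReal_mono fun η hη => ?_) (measureReal_union_le _ _)
    by_cases h : ∃ x, R (n + 1) < η x
    · exact Or.inl h
    · right
      push Not at h
      have hle : N (n + 1) ≤ ∑ y, η y + R (n + 1) := by
        by_contra hlt
        exact hη ⟨not_le.1 hlt, h⟩
      have hle' : (N (n + 1) : ℝ) ≤ ((∑ y, η y : ℕ) : ℝ) + R (n + 1) := by exact_mod_cast hle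
      change fluidDensity c₀ c₁ * n + t n * √((n + 1 : ℕ) : ℝ) ≤ ((∑ y, η y : ℕ) : ℝ)
      -- The excess `t n` is measured from the mean of `n + 1` sites; the background has only `n`,
      -- so the inequality goes the right way.
      rw [← hx]
      push_cast at hle' ⊢
      linarith
  linarith

/-- Strictly above the threshold the excess is linear in `L`, which beats `√L`. -/
theorem tendsto_fluctuation
    (hR : Tendsto (fun L : ℕ => (R L : ℝ) / L) atTop (𝓝 a))
    (hN : Tendsto (fun L : ℕ => (N L : ℝ) / L) atTop (𝓝 ρ)) {ρc : ℝ} (hρ : ρc + a < ρ) :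
    Tendsto (fun L : ℕ => ((N L : ℝ) - R L - ρc * L) / √(L : ℝ)) atTop atTop := by
  have h := (hN.sub hR).sub_const ρc
  have hs : Tendsto (fun L : ℕ => √(L : ℝ)) atTop atTop :=
    Real.tendsto_sqrt_atTop.comp tendsto_natCast_atTop_atTop
  refine (h.pos_mul_atTop (by linarith) hs).congr' ?_
  filter_upwards [eventually_gt_atTop 0] with L hL
  have hL' : (0 : ℝ) < L := by exact_mod_cast hL
  have hs : 0 < √(L : ℝ) := by positivity
  have e : (L : ℝ) = √(L : ℝ) * √(L : ℝ) := (Real.mul_self_sqrt hL'.le).symm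
  rw [← sub_div, eq_div_iff hs.ne', mul_assoc, ← e]
  field_simp

theorem tendsto_klDiv_condensedBackground (hc₁ : 0 < c₁) (hc : c₁ < c₀) (ha : 0 < a)
    (hR : Tendsto (fun L : ℕ => (R L : ℝ) / L) atTop (𝓝 a))
    (ht : Tendsto (fun L : ℕ =>
      ((N L : ℝ) - R L - criticalDensity c₀ c₁ * L) / √(L : ℝ)) atTop atTop) :
    Tendsto (fun n : ℕ => klDiv (condensedBackground c₀ c₁ (R (n + 1)) n (N (n + 1)))
      (fluidProduct c₀ c₁ n)) atTop (𝓝 0) := by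
  have := isProbabilityMeasure_fluidProduct hc₁.le hc
  have hB := tendsto_real_backgroundConfig hc₁ hc ha hR ht
  have h := ENNReal.tendsto_ofReal (hB.log one_ne_zero).neg
  rw [Real.log_one, neg_zero, ENNReal.ofReal_zero] at h
  refine h.congr' ?_
  filter_upwards [hB.eventually_ne one_ne_zero] with n hn
  rw [condensedBackground_eq hc₁ hc, klDiv_cond _ .of_discrete]
  intro h
  exact hn (by rw [measureReal_def, h]; rfl)

end Phases

end ZRP

theorem mainTheorem8 (c₀ c₁ a ρ : ℝ) (hc₁ : 0 < c₁) (hc : c₁ < c₀) (ha : 0 < a) (hρ : 0 ≤ ρ)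
    (R N : ℕ → ℕ)
    (hR : Tendsto (fun L : ℕ => (R L : ℝ) / L) atTop (𝓝 a))
    (hN : Tendsto (fun L : ℕ => (N L : ℝ) / L) atTop (𝓝 ρ)) :
    -- the fluid phase
    (((ρ = 0 → ∀ᶠ L in atTop, N L = 0) →
        Tendsto (fun L : ℕ =>
          klDiv (ZRP.quasiStationary c₀ c₁ (R L) L (N L) 0)
            (ZRP.fluidProduct c₀ (ZRP.fluidFugacity c₀ ρ) L) / (L : ℝ≥0∞)) atTop (𝓝 0)) ∧
      ZRP.ConvergesWeakly (fun L => ZRP.quasiStationary c₀ c₁ (R L) L (N L) 0)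
        (ZRP.fluidInfinite c₀ (ZRP.fluidFugacity c₀ ρ))) ∧
    -- the condensed phase
    (ZRP.criticalDensity c₀ c₁ + a ≤ ρ →
      ((ρ = ZRP.criticalDensity c₀ c₁ + a →
          Tendsto (fun L : ℕ =>
            ((N L : ℝ) - R L - ZRP.criticalDensity c₀ c₁ * L) / √(L : ℝ)) atTop atTop) →
        Tendsto (fun n : ℕ =>
          klDiv (ZRP.condensedBackground c₀ c₁ (R (n + 1)) n (N (n + 1)))
            (ZRP.fluidProduct c₀ c₁ n)) atTop (𝓝 0)) ∧
      ZRP.ConvergesWeakly (fun L => ZRP.quasiStationary c₀ c₁ (R L) L (N L) 1)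
        (ZRP.fluidInfinite c₀ c₁)) := by
  refine ⟨⟨ZRP.tendsto_klDiv_quasiStationary_zero hc₁ hc ha hρ hR hN,
    ZRP.convergesWeakly_quasiStationary_zero hc₁ hc ha hρ hR hN⟩, fun hle => ⟨fun hcrit => ?_,
    ZRP.convergesWeakly_quasiStationary_one_of_le hc₁ hc ha hR hN hle⟩⟩
  refine ZRP.tendsto_klDiv_condensedBackground hc₁ hc ha hR ?_
  rcases hle.eq_or_lt with h | h
  · exact hcrit h.symm
  · exact ZRP.tendsto_fluctuation hR hN h
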